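/- Let $n\ge 1$. For $s\in(0,1)$ and $\varphi\in C_c^\infty(\mathbb R^n)$ let $$D^s\varphi(x):=c_{s,n}\lim_{\varepsilon\searrow0}\int_{\mathbb R^n\setminus B_\varepsilon}\frac{z\,\varphi(x+z)}{|z|^{n+s+1}}\,dz,\qquad c_{s,n}:=\frac{2^s\pi^{-n/2}\,\Gamma\!\left(\frac{n+s+1}{2}\right)}{\Gamma\!\left(\frac{1-s}{2}\right)},$$ where $B_\varepsilon$ is the open ball of radius $\varepsilon$ centred at the origin. For $p\in[1,\infty)$ and $u\in L^p(\mathbb R^n)$, if there are $\varphi_k\in C_c^\infty(\mathbb R^n)$ with $\varphi_k\to u$ in $L^p(\mathbb R^n)$ and with $(D^s\varphi_k)$ Cauchy in $L^p(\mathbb R^n,\mathbb R^n)$, then $D^su$ denotes the limit of $D^s\varphi_k$ in $L^p(\mathbb R^n,\mathbb R^n)$ (it does not depend on the choice of the sequence). For a bounded open set $\Omega\subset\mathbb R^n$, $H^{s,p}_0(\Omega)$ denotes the closure of $C_c^\infty(\Omega)$ with respect to the norm $$\|u\|_{H^{s,p}(\mathbb R^n)}:=\left(\|u\|_{L^p(\mathbb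 R^n)}^p+\|D^su\|_{L^p(\mathbb R^n)}^p\right)^{1/p},$$ that is, the set of all $L^p(\mathbb R^n)$-limits of sequences in $C_c^\infty(\Omega)$ that are Cauchy in this norm. **Proposition.** Let $\bar s\in(0,1)$ and let $\Omega\subset\mathbb R^n$ be a bounded open set. Then there exists $C>0$, depending only on $n$, $\bar s$ and $\Omega$, such that for all $s\in[\bar s,1)$, all $p\in[1,\infty)$ and all $u\in H^{s,p}_0(\Omega)$, the fractional gradient $D^{\bar s}u\in L^p(\mathbb R^n,\mathbb R^n)$ is well defined and $$\|D^{\bar s}u\|_{L^p(\mathbb R^n)}\le C\,\|D^su\|_{L^p(\mathbb R^n)}.$$ -/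

import Mathlib

open MeasureTheory Filter Topology
open scoped ENNReal Distributions

noncomputable section

/-- The normalizing constant
`c_{s,n} = 2^s π^{-n/2} Γ((n+s+1)/2) / Γ((1-s)/2)`, for `s ∈ [-1,1)`. -/
def fracConst (n : ℕ) (s : ℝ) : ℝ :=
  2 ^ s * Real.pi ^ (-((n : ℝ) / 2)) * Real.Gamma (((n : ℝ) + s + 1) / 2) /
    Real.Gamma ((1 - s) / 2)

/-- The pointwise fractional gradient of order `s ∈ (0,1]` of a test function `φ`:
`D^s φ (x) = c_{s,n} lim_{ε ↘ 0} ∫_{ℝⁿ ∖ B_ε} z φ(x+z) / |z|^{n+s+1} dz` for `s < 1`,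
and the classical gradient for `s = 1`. -/
def testFracGrad {n : ℕ} (s : ℝ) (φ : EuclideanSpace ℝ (Fin n) → ℝ)
    (x : EuclideanSpace ℝ (Fin n)) : EuclideanSpace ℝ (Fin n) :=
  if s = 1 then gradient φ x
  else fracConst n s •
    limUnder (𝓝[>] (0 : ℝ)) fun ε : ℝ =>
      ∫ z in (Metric.ball (0 : EuclideanSpace ℝ (Fin n)) ε)ᶜ,
        (φ (x + z) / ‖z‖ ^ ((n : ℝ) + s + 1)) • z

/-- `g` is a fractional gradient of order `s` of `u ∈ L^p(ℝⁿ)`: there are test functions `φ k` on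
`ℝⁿ` converging to `u` in `L^p(ℝⁿ)` whose fractional gradients `D^s (φ k)` converge to `g` in
`L^p(ℝⁿ, ℝⁿ)`. -/
def IsFracGrad {n : ℕ} (s : ℝ) (p : ℝ≥0∞) (u : EuclideanSpace ℝ (Fin n) → ℝ)
    (g : EuclideanSpace ℝ (Fin n) → EuclideanSpace ℝ (Fin n)) : Prop :=
  MemLp u p volume ∧ MemLp g p volume ∧
    ∃ φ : ℕ → 𝓓((⊤ : TopologicalSpace.Opens (EuclideanSpace ℝ (Fin n))), ℝ),
      Tendsto (fun k => eLpNorm (fun x => φ k x - u x) p volume) atTop (𝓝 0) ∧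
      Tendsto (fun k => eLpNorm (fun x => testFracGrad s (φ k) x - g x) p volume) atTop (𝓝 0)

open Classical in
/-- The fractional gradient `D^s u` of `u ∈ L^p(ℝⁿ)`, determined up to equality almost everywhere
(and set to `0` if `u` has no fractional gradient of order `s` in `L^p`). -/
def fracGrad {n : ℕ} (s : ℝ) (p : ℝ≥0∞) (u : EuclideanSpace ℝ (Fin n) → ℝ) :
    EuclideanSpace ℝ (Fin n) → EuclideanSpace ℝ (Fin n) :=
  if h : ∃ g, IsFracGrad s p u g then h.choose else 0

/-- The norm `‖φ‖_{H^{s,p}(ℝⁿ)} = (‖φ‖_{L^p}^p + ‖D^s φ‖_{L^p}^p)^{1/p}` of a test function. -/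
def fracSobolevNorm {n : ℕ} (s : ℝ) (p : ℝ≥0∞) (φ : EuclideanSpace ℝ (Fin n) → ℝ) : ℝ≥0∞ :=
  (eLpNorm φ p volume ^ p.toReal + eLpNorm (testFracGrad s φ) p volume ^ p.toReal) ^ p.toReal⁻¹

/-- `u ∈ H^{s,p}_0(Ω)`, the closure of `𝓓(Ω)` in the norm of `H^{s,p}(ℝⁿ)`, realized inside
`L^p(ℝⁿ)`: `u` is the `L^p(ℝⁿ)`-limit of a sequence in `𝓓(Ω)` which is Cauchy in the norm of
`H^{s,p}(ℝⁿ)`. -/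
def MemFracSobolevZero {n : ℕ} (Ω : TopologicalSpace.Opens (EuclideanSpace ℝ (Fin n)))
    (s : ℝ) (p : ℝ≥0∞) (u : EuclideanSpace ℝ (Fin n) → ℝ) : Prop :=
  MemLp u p volume ∧
    ∃ φ : ℕ → 𝓓(Ω, ℝ),
      Tendsto (fun k => eLpNorm (fun x => φ k x - u x) p volume) atTop (𝓝 0) ∧
      ∀ ε : ℝ≥0∞, 0 < ε → ∃ N : ℕ, ∀ j k : ℕ, N ≤ j → N ≤ k →
        fracSobolevNorm s p (fun x => φ j x - φ k x) < ε

end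

/-!
The proof compares fractional gradients of different orders through the heat semigroup
`P_t = exp (t Δ)`, for which all estimates have constants independent of `p`.

For a test function `f` and `s ∈ (0, 1)` the fractional gradient is a superposition of gradients of
the heat flow, `D^s f = ∫ ∇P_t f dγ_α(t)` with `α = (1 - s) / 2` and `γ_α = t ^ (α - 1) / Γ(α) dt`
(`testFracGrad_eq_integral_heatGrad`). The measures satisfy `γ_a ∗ γ_b = γ_{a + b}`
(`map_add_prod_rieszMeasure`), so the semigroup law of the heat kernel gives two identities, in
which all integrals converge absolutely:

* `D^{s̄} f = ∫ P_t D^s f dγ_a(t)` with `a = (s - s̄) / 2`. The times `t ≤ T` contribute at most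
  `γ_a((0, T]) ‖D^s f‖_p = T ^ a / Γ(a + 1) ‖D^s f‖_p`, since `P_t` is an average of translations.
  The times `t > T` only see `∇P_τ f` with `τ > T`, and contribute at most
  `C T ^ (-s̄ / 2) ‖f‖_p` (`eLpNorm_rieszGrad_add_le`). The factor `1 / Γ(a)` in `γ_a` is what makes
  the bound uniform as `s → s̄`.
* `-f = ∫ ΔP_τ f dτ = ∫ div P_t D^{s̄} f dγ_{1 - α}(t)` with `α = (1 - s̄) / 2`. The same splitting
  bounds `‖f‖_p` by `C_T ‖D^{s̄} f‖_p` plus `C T ^ (-n / 2)` times an integral of `|f|` over a ball,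
  which is absorbed for large `T` when `f` is supported in a fixed ball. This is a Poincaré
  inequality for the order `s̄` (`exists_eLpNorm_le_mul_eLpNorm_rieszGrad`).

Inserting the second estimate into the first and choosing `T` large, the long time contribution is
absorbed into `‖D^{s̄} f‖_p` (`exists_eLpNorm_rieszGrad_add_le`). All bounds in `L^p` come from
Minkowski's inequality for averages of translates, which has constant `1` for every `p`.

The passage from test functions to `H^{s,p}_0(Ω)` uses the completeness of `L^p`, and the fact that
fractional gradients are unique: integration by parts against a test function `η` is continuous in
`L^p` since `D^s η` belongs to every `L^q` (`ae_eq_zero_of_tendsto_rieszGrad`).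
-/

/-! ### Averages of translates in `L^p` -/

/-- Minkowski's inequality for averages of translates: a function which is dominated pointwise by
an average of translates of `f` over a measure `μ` has `L^p` norm at most `μ univ` times that
of `f`. -/
theorem eLpNorm_le_of_enorm_le_lintegral_translate {E V W Y : Type*} [NormedAddCommGroup E]
    [MeasurableSpace E] [BorelSpace E] [SecondCountableTopology E] {ν : Measure E} [SFinite ν]
    [ν.IsAddRightInvariant] [NormedAddCommGroup V] [ENorm W] [MeasurableSpace Y]
    (μ : Measure Y) [IsFiniteMeasure μ] {σ : Y → E} (hσ : Measurable σ) {f : E → V}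
    (hf : StronglyMeasurable f) {F : E → W} {p : ℝ≥0∞} (hp : 1 ≤ p) (hp' : p ≠ ∞)
    (hF : ∀ x, ‖F x‖ₑ ≤ ∫⁻ y, ‖f (x + σ y)‖ₑ ∂μ) :
    eLpNorm F p ν ≤ μ Set.univ * eLpNorm f p ν := by
  have hq : 1 ≤ p.toReal := by
    rw [← ENNReal.toReal_one]; exact ENNReal.toReal_mono hp' hp
  have hq0 : 0 < p.toReal := by linarith
  have hp0 : p ≠ 0 := (zero_lt_one.trans_le hp).ne'
  have hmeas : Measurable fun z : E × Y => ‖f (z.1 + σ z.2)‖ₑ :=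
    hf.enorm.comp (measurable_fst.add (hσ.comp measurable_snd))
  have key : ∀ x, ‖F x‖ₑ ^ p.toReal ≤
      μ Set.univ ^ (p.toReal - 1) * ∫⁻ y, ‖f (x + σ y)‖ₑ ^ p.toReal ∂μ := by
    intro x
    have hm : Measurable fun y => ‖f (x + σ y)‖ₑ := hmeas.comp measurable_prodMk_left
    have h0 := eLpNorm'_le_eLpNorm'_mul_rpow_measure_univ one_pos hq
      (μ := μ) hm.aestronglyMeasurable
    simp only [eLpNorm'_eq_lintegral_enorm, enorm_eq_self, ENNReal.rpow_one, div_one] at h0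
    refine (ENNReal.rpow_le_rpow ((hF x).trans h0) hq0.le).trans_eq ?_
    rw [ENNReal.mul_rpow_of_nonneg _ _ hq0.le, ← ENNReal.rpow_mul, ← ENNReal.rpow_mul,
      one_div, inv_mul_cancel₀ hq0.ne', ENNReal.rpow_one, sub_mul, one_mul,
      inv_mul_cancel₀ hq0.ne', mul_comm]
  have hmp : Measurable fun z : E × Y => ‖f (z.1 + σ z.2)‖ₑ ^ p.toReal := hmeas.pow_const _
  have hM : μ Set.univ ≠ ∞ := measure_ne_top μ _
  have hint : ∫⁻ x, ‖F x‖ₑ ^ p.toReal ∂ν ≤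
      μ Set.univ ^ p.toReal * ∫⁻ x, ‖f x‖ₑ ^ p.toReal ∂ν := by
    calc ∫⁻ x, ‖F x‖ₑ ^ p.toReal ∂ν
        ≤ ∫⁻ x, μ Set.univ ^ (p.toReal - 1) * ∫⁻ y, ‖f (x + σ y)‖ₑ ^ p.toReal ∂μ ∂ν :=
          lintegral_mono key
      _ = μ Set.univ ^ (p.toReal - 1) * ∫⁻ x, ∫⁻ y, ‖f (x + σ y)‖ₑ ^ p.toReal ∂μ ∂ν :=
          lintegral_const_mul _ hmp.lintegral_prod_right'
      _ = μ Set.univ ^ (p.toReal - 1) * ∫⁻ y, ∫⁻ x, ‖f (x + σ y)‖ₑ ^ p.toReal ∂ν ∂μ := by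
          rw [lintegral_lintegral_swap hmp.aemeasurable]
      _ = μ Set.univ ^ (p.toReal - 1) * (μ Set.univ * ∫⁻ x, ‖f x‖ₑ ^ p.toReal ∂ν) := by
          simp_rw [lintegral_add_right_eq_self (fun x => ‖f x‖ₑ ^ p.toReal)]
          rw [lintegral_const, mul_comm (μ Set.univ)]
      _ = μ Set.univ ^ p.toReal * ∫⁻ x, ‖f x‖ₑ ^ p.toReal ∂ν := by
          rw [← mul_assoc]
          congr 1
          rcases eq_or_ne (μ Set.univ) 0 with h | h
          · rw [h, mul_zero, ENNReal.zero_rpow_of_pos hq0]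
          · nth_rewrite 2 [← ENNReal.rpow_one (μ Set.univ)]
            rw [← ENNReal.rpow_add _ _ h hM, sub_add_cancel]
  rw [eLpNorm_eq_lintegral_rpow_enorm_toReal hp0 hp', eLpNorm_eq_lintegral_rpow_enorm_toReal hp0 hp']
  refine (ENNReal.rpow_le_rpow hint (by positivity)).trans_eq ?_
  rw [ENNReal.mul_rpow_of_nonneg _ _ (by positivity), ← ENNReal.rpow_mul, mul_one_div,
    div_self hq0.ne', ENNReal.rpow_one]

/-! ### The measures `t ^ (α - 1) / Γ(α) dt` -/

/-- The density `t ^ (α - 1) / Γ(α)` on `(0, ∞)`, extended by zero to the real line. -/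
noncomputable def rieszDensity (α t : ℝ) : ℝ≥0∞ :=
  (Set.Ioi (0 : ℝ)).indicator (fun t => ENNReal.ofReal (t ^ (α - 1) / Real.Gamma α)) t

/-- The measure `t ^ (α - 1) / Γ(α) dt` on `(0, ∞)`, which subordinates the Riesz potential of
order `2 * α` to the heat semigroup. -/
noncomputable def rieszMeasure (α : ℝ) : Measure ℝ := volume.withDensity (rieszDensity α)

theorem measurable_rieszDensity (α : ℝ) : Measurable (rieszDensity α) :=
  Measurable.indicator (by fun_prop) measurableSet_Ioi

theorem rieszDensity_of_nonpos {α t : ℝ} (ht : t ≤ 0) : rieszDensity α t = 0 := by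
  simp [rieszDensity, ht]

theorem rieszDensity_of_pos {α t : ℝ} (ht : 0 < t) :
    rieszDensity α t = ENNReal.ofReal (t ^ (α - 1) / Real.Gamma α) := by
  simp [rieszDensity, ht]

theorem rieszDensity_mul {α τ : ℝ} (hτ : 0 < τ) (u : ℝ) :
    rieszDensity α (τ * u) = ENNReal.ofReal (τ ^ (α - 1)) * rieszDensity α u := by
  rcases le_or_gt u 0 with hu | hu
  · rw [rieszDensity_of_nonpos hu, rieszDensity_of_nonpos (mul_nonpos_of_nonneg_of_nonpos hτ.le hu),
      mul_zero]
  · rw [rieszDensity_of_pos hu, rieszDensity_of_pos (by positivity), ← ENNReal.ofReal_mul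
      (by positivity), Real.mul_rpow hτ.le hu.le, mul_div_assoc]

theorem lintegral_rieszMeasure (α : ℝ) {F : ℝ → ℝ≥0∞} (hF : Measurable F) :
    ∫⁻ t, F t ∂rieszMeasure α = ∫⁻ t, rieszDensity α t * F t := by
  rw [rieszMeasure, lintegral_withDensity_eq_lintegral_mul _ (measurable_rieszDensity α) hF]
  rfl

theorem rieszMeasure_Iic_zero (α : ℝ) : rieszMeasure α (Set.Iic 0) = 0 := by
  rw [rieszMeasure, withDensity_apply _ measurableSet_Iic]
  refine (setLIntegral_congr_fun measurableSet_Iic fun t ht => rieszDensity_of_nonpos ht).trans ?_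
  simp

theorem ae_rieszMeasure_pos (α : ℝ) : ∀ᵐ t ∂rieszMeasure α, 0 < t := by
  rw [ae_iff]
  simpa [Set.Iic] using rieszMeasure_Iic_zero α

instance sigmaFinite_rieszMeasure (α : ℝ) : SigmaFinite (rieszMeasure α) := by
  refine SigmaFinite.withDensity_of_ne_top (ae_of_all _ fun t => ?_)
  rcases le_or_gt t 0 with ht | ht
  · simp [rieszDensity_of_nonpos ht]
  · simp [rieszDensity_of_pos ht]

theorem rieszMeasure_one : rieszMeasure 1 = volume.restrict (Set.Ioi 0) := by
  rw [rieszMeasure, ← withDensity_indicator_one measurableSet_Ioi]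
  congr 1
  ext t
  simp [rieszDensity, Set.indicator]

theorem lintegral_exp_neg_rieszMeasure {α : ℝ} (hα : 0 < α) :
    ∫⁻ t, ENNReal.ofReal (Real.exp (-t)) ∂rieszMeasure α = 1 := by
  rw [lintegral_rieszMeasure α (by fun_prop)]
  have hΓ := Real.Gamma_pos_of_pos hα
  have h1 : ∀ t, rieszDensity α t * ENNReal.ofReal (Real.exp (-t)) = (Set.Ioi (0 : ℝ)).indicator
      (fun t => ENNReal.ofReal (Real.exp (-t) * t ^ (α - 1) / Real.Gamma α)) t := by
    intro t
    rcases le_or_gt t 0 with ht | ht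
    · simp [rieszDensity_of_nonpos ht, ht]
    · rw [rieszDensity_of_pos ht, ← ENNReal.ofReal_mul (by positivity),
        Set.indicator_of_mem (Set.mem_Ioi.2 ht)]
      congr 1
      ring
  simp_rw [h1]
  rw [lintegral_indicator measurableSet_Ioi, ← ofReal_integral_eq_lintegral_ofReal
    ((Real.GammaIntegral_convergent hα).div_const _), integral_div, ← Real.Gamma_eq_integral hα,
    div_self hΓ.ne', ENNReal.ofReal_one]
  filter_upwards [ae_restrict_mem measurableSet_Ioi] with t ht
  have : 0 < t := ht
  positivity

/-- The convolution of the densities is homogeneous, which determines it up to a constant. -/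
theorem lintegral_rieszDensity_mul_rieszDensity_sub {α β : ℝ} (hαβ : 0 < α + β) :
    ∃ K : ℝ≥0∞, ∀ τ, ∫⁻ t, rieszDensity α t * rieszDensity β (τ - t) =
      K * rieszDensity (α + β) τ := by
  have hΓ := Real.Gamma_pos_of_pos hαβ
  refine ⟨(∫⁻ u, rieszDensity α u * rieszDensity β (1 - u)) * ENNReal.ofReal (Real.Gamma (α + β)),
    fun τ => ?_⟩
  rcases le_or_gt τ 0 with hτ | hτ
  · rw [rieszDensity_of_nonpos hτ, mul_zero]
    refine (lintegral_congr fun t => ?_).trans lintegral_zero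
    rcases le_or_gt t 0 with ht | ht
    · rw [rieszDensity_of_nonpos ht, zero_mul]
    · rw [rieszDensity_of_nonpos (by linarith : τ - t ≤ 0), mul_zero]
  · have hm : Measurable fun t => rieszDensity α t * rieszDensity β (τ - t) :=
      (measurable_rieszDensity α).mul ((measurable_rieszDensity β).comp (by fun_prop))
    have hm1 : Measurable fun u => rieszDensity α u * rieszDensity β (1 - u) :=
      (measurable_rieszDensity α).mul ((measurable_rieszDensity β).comp (by fun_prop))
    have h2 : ∀ u, rieszDensity α (τ * u) * rieszDensity β (τ - τ * u) =
        ENNReal.ofReal (τ ^ (α - 1) * τ ^ (β - 1)) *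
          (rieszDensity α u * rieszDensity β (1 - u)) := by
      intro u
      rw [show τ - τ * u = τ * (1 - u) by ring, rieszDensity_mul hτ, rieszDensity_mul hτ,
        ENNReal.ofReal_mul (by positivity)]
      ring
    nth_rewrite 1 [← Real.smul_map_volume_mul_left hτ.ne']
    rw [lintegral_smul_measure, lintegral_map hm (by fun_prop)]
    simp_rw [h2]
    rw [lintegral_const_mul _ hm1, rieszDensity_of_pos hτ, abs_of_pos hτ, mul_assoc,
      ← ENNReal.ofReal_mul hΓ.le, mul_comm (lintegral _ _), smul_eq_mul, ← mul_assoc,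
      ← ENNReal.ofReal_mul hτ.le]
    congr 2
    rw [mul_div_cancel₀ _ hΓ.ne', ← Real.rpow_add hτ]
    nth_rewrite 1 [← Real.rpow_one τ]
    rw [← Real.rpow_add hτ]
    congr 1
    ring

/-- The semigroup law of the measures `rieszMeasure α` under convolution; the constant in the
preceding lemma is found by integrating `exp (-t)`. -/
theorem map_add_prod_rieszMeasure {α β : ℝ} (hα : 0 < α) (hβ : 0 < β) :
    ((rieszMeasure α).prod (rieszMeasure β)).map (fun z => z.1 + z.2) = rieszMeasure (α + β) := by
  obtain ⟨K, hK⟩ := lintegral_rieszDensity_mul_rieszDensity_sub (add_pos hα hβ)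
  have key : ∀ F : ℝ → ℝ≥0∞, Measurable F →
      ∫⁻ t, ∫⁻ r, F (t + r) ∂rieszMeasure β ∂rieszMeasure α =
        K * ∫⁻ τ, F τ ∂rieszMeasure (α + β) := by
    intro F hF
    have hmα := measurable_rieszDensity α
    have hmβ := measurable_rieszDensity β
    calc ∫⁻ t, ∫⁻ r, F (t + r) ∂rieszMeasure β ∂rieszMeasure α
        = ∫⁻ t, rieszDensity α t * ∫⁻ r, rieszDensity β r * F (t + r) := by
          rw [lintegral_rieszMeasure]
          · exact lintegral_congr fun t => congrArg _
              (lintegral_rieszMeasure β (hF.comp (measurable_const_add t)))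
          · exact Measurable.lintegral_prod_right (hF.comp (measurable_fst.add measurable_snd))
      _ = ∫⁻ t, ∫⁻ τ, rieszDensity α t * (rieszDensity β (τ - t) * F τ) := by
          refine lintegral_congr fun t => ?_
          rw [← lintegral_sub_right_eq_self _ t, ← lintegral_const_mul]
          · simp
          · exact (hmβ.comp (by fun_prop)).mul (hF.comp (by fun_prop))
      _ = ∫⁻ τ, ∫⁻ t, rieszDensity α t * (rieszDensity β (τ - t) * F τ) := by
          rw [lintegral_lintegral_swap]
          exact ((hmα.comp measurable_fst).mul ((hmβ.comp (measurable_snd.sub measurable_fst)).mul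
            (hF.comp measurable_snd))).aemeasurable
      _ = ∫⁻ τ, K * (rieszDensity (α + β) τ * F τ) := by
          refine lintegral_congr fun τ => ?_
          have hm : Measurable fun t => rieszDensity α t * rieszDensity β (τ - t) :=
            hmα.mul (hmβ.comp (by fun_prop))
          simp_rw [← mul_assoc]
          rw [lintegral_mul_const _ hm, hK]
      _ = K * ∫⁻ τ, F τ ∂rieszMeasure (α + β) := by
          have hm : Measurable fun τ => rieszDensity (α + β) τ * F τ :=
            (measurable_rieszDensity _).mul hF
          rw [lintegral_const_mul _ hm, lintegral_rieszMeasure _ hF]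
  have hK1 : K = 1 := by
    have h := key (fun t => ENNReal.ofReal (Real.exp (-t))) (by fun_prop)
    simp_rw [neg_add, Real.exp_add, ENNReal.ofReal_mul (Real.exp_pos _).le] at h
    simp_rw [lintegral_const_mul _ (show Measurable fun t : ℝ => ENNReal.ofReal (Real.exp (-t)) by
      fun_prop)] at h
    rw [lintegral_exp_neg_rieszMeasure hβ, lintegral_exp_neg_rieszMeasure (add_pos hα hβ)] at h
    simp_rw [mul_one] at h
    rw [lintegral_exp_neg_rieszMeasure hα] at h
    exact h.symm
  refine Measure.ext_of_lintegral _ fun F hF => ?_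
  have hm : Measurable fun z : ℝ × ℝ => F (z.1 + z.2) :=
    hF.comp (measurable_fst.add measurable_snd)
  rw [lintegral_map hF (by fun_prop), lintegral_prod _ hm.aemeasurable, key F hF, hK1, one_mul]

theorem lintegral_Iic_rpow_rieszMeasure {α c T : ℝ} (hα : 0 < α) (hc : 0 < α + c) (hT : 0 < T) :
    ∫⁻ t in Set.Iic T, ENNReal.ofReal (t ^ c) ∂rieszMeasure α =
      ENNReal.ofReal (T ^ (α + c) / ((α + c) * Real.Gamma α)) := by
  have hΓ := Real.Gamma_pos_of_pos hα
  have hm : Measurable fun t : ℝ => ENNReal.ofReal (t ^ c) := by fun_prop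
  rw [← lintegral_indicator measurableSet_Iic,
    lintegral_rieszMeasure α (hm.indicator measurableSet_Iic)]
  have h1 : ∀ t, rieszDensity α t * (Set.Iic T).indicator (fun t => ENNReal.ofReal (t ^ c)) t =
      (Set.Ioc 0 T).indicator (fun t => ENNReal.ofReal (t ^ (α + c - 1) / Real.Gamma α)) t := by
    intro t
    rcases le_or_gt t 0 with ht | ht
    · simp [rieszDensity_of_nonpos ht, ht]
    · by_cases htT : t ≤ T
      · rw [rieszDensity_of_pos ht, Set.indicator_of_mem (Set.mem_Iic.2 htT),
          Set.indicator_of_mem (Set.mem_Ioc.2 ⟨ht, htT⟩), ← ENNReal.ofReal_mul (by positivity),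
          div_mul_eq_mul_div, ← Real.rpow_add ht]
        ring_nf
      · simp [htT]
  simp_rw [h1]
  have hi : IntervalIntegrable (fun t : ℝ => t ^ (α + c - 1)) volume 0 T :=
    intervalIntegral.intervalIntegrable_rpow' (by linarith)
  rw [intervalIntegrable_iff_integrableOn_Ioc_of_le hT.le] at hi
  rw [lintegral_indicator measurableSet_Ioc, ← ofReal_integral_eq_lintegral_ofReal
    (hi.div_const _), integral_div, ← intervalIntegral.integral_of_le hT.le,
    integral_rpow (Or.inl (by linarith)), sub_add_cancel, Real.zero_rpow hc.ne', sub_zero, div_div]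
  filter_upwards [ae_restrict_mem measurableSet_Ioc] with t ht
  have : 0 < t := ht.1
  positivity

theorem rieszMeasure_Iic {α T : ℝ} (hα : 0 < α) (hT : 0 < T) :
    rieszMeasure α (Set.Iic T) = ENNReal.ofReal (T ^ α / Real.Gamma (α + 1)) := by
  have h := lintegral_Iic_rpow_rieszMeasure (c := 0) hα (by simpa using hα) hT
  simpa [Real.Gamma_add_one hα.ne'] using h

theorem lintegral_Ioi_rpow_rieszMeasure {α c T : ℝ} (hα : 0 < α) (hc : α + c < 0) (hT : 0 < T) :
    ∫⁻ t in Set.Ioi T, ENNReal.ofReal (t ^ c) ∂rieszMeasure α =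
      ENNReal.ofReal (T ^ (α + c) / (-(α + c) * Real.Gamma α)) := by
  have hΓ := Real.Gamma_pos_of_pos hα
  have hm : Measurable fun t : ℝ => ENNReal.ofReal (t ^ c) := by fun_prop
  rw [← lintegral_indicator measurableSet_Ioi,
    lintegral_rieszMeasure α (hm.indicator measurableSet_Ioi)]
  have h1 : ∀ t, rieszDensity α t * (Set.Ioi T).indicator (fun t => ENNReal.ofReal (t ^ c)) t =
      (Set.Ioi T).indicator (fun t => ENNReal.ofReal (t ^ (α + c - 1) / Real.Gamma α)) t := by
    intro t
    by_cases htT : T < t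
    · have ht : 0 < t := hT.trans htT
      rw [rieszDensity_of_pos ht, Set.indicator_of_mem (Set.mem_Ioi.2 htT),
        Set.indicator_of_mem (Set.mem_Ioi.2 htT), ← ENNReal.ofReal_mul (by positivity),
        div_mul_eq_mul_div, ← Real.rpow_add ht]
      ring_nf
    · simp [htT]
  simp_rw [h1]
  have hi := integrableOn_Ioi_rpow_of_lt (show α + c - 1 < -1 by linarith) hT
  rw [lintegral_indicator measurableSet_Ioi, ← ofReal_integral_eq_lintegral_ofReal
    (hi.div_const _), integral_div, integral_Ioi_rpow_of_lt (by linarith) hT, sub_add_cancel]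
  · congr 1
    rw [neg_mul, div_div, div_neg, neg_div]
  · filter_upwards [ae_restrict_mem measurableSet_Ioi] with t ht
    have : 0 < t := hT.trans ht
    positivity

/-- The function `t ↦ min 1 (t ^ (-1/2))`, which controls the gradient of the heat flow of a
compactly supported Lipschitz function, is integrable for small exponents. -/
theorem integrable_min_one_rpow_rieszMeasure {α : ℝ} (hα : 0 < α) (hα' : α < 1 / 2) :
    Integrable (fun t : ℝ => min 1 (t ^ (-(1 / 2) : ℝ))) (rieszMeasure α) := by
  have hm : Measurable fun t : ℝ => min 1 (t ^ (-(1 / 2) : ℝ)) := by fun_prop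
  refine ⟨hm.aestronglyMeasurable, ?_⟩
  rw [hasFiniteIntegral_iff_enorm, ← lintegral_add_compl _ (measurableSet_Iic (a := (1 : ℝ)))]
  refine ENNReal.add_lt_top.2 ⟨?_, ?_⟩
  · refine (setLIntegral_mono_ae (g := fun t => ENNReal.ofReal (t ^ (0 : ℝ))) (by fun_prop)
      ?_).trans_lt ?_
    · filter_upwards [ae_rieszMeasure_pos α] with t ht _
      rw [Real.enorm_of_nonneg (by positivity), Real.rpow_zero]
      exact ENNReal.ofReal_le_ofReal (min_le_left _ _)
    · rw [lintegral_Iic_rpow_rieszMeasure hα (by simpa using hα) one_pos]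
      exact ENNReal.ofReal_lt_top
  · rw [Set.compl_Iic]
    refine (setLIntegral_mono_ae (g := fun t => ENNReal.ofReal (t ^ (-(1 / 2) : ℝ)))
      (by fun_prop) ?_).trans_lt ?_
    · filter_upwards [ae_rieszMeasure_pos α] with t ht _
      rw [Real.enorm_of_nonneg (by positivity)]
      exact ENNReal.ofReal_le_ofReal (min_le_right _ _)
    · rw [lintegral_Ioi_rpow_rieszMeasure hα (by linarith) one_pos]
      exact ENNReal.ofReal_lt_top

/-! ### The heat kernel -/

section HeatKernel

open Module

variable {E : Type*} [NormedAddCommGroup E] [InnerProductSpace ℝ E]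

/-- The heat kernel `(4πt)^(-d/2) exp(-|z|²/(4t))` of a Euclidean space of dimension `d`. -/
noncomputable def heatKernel (t : ℝ) (z : E) : ℝ :=
  (4 * Real.pi * t) ^ (-((finrank ℝ E : ℝ) / 2)) * Real.exp (-‖z‖ ^ 2 / (4 * t))

/-- The vector kernel `z / (2t) * heatKernel t z`, the negative of the spatial gradient of the heat
kernel. -/
noncomputable def heatGradKernel (t : ℝ) (z : E) : E := (heatKernel t z / (2 * t)) • z

/-- The kernel `(|z|²/(4t²) - d/(2t)) * heatKernel t z`, which is the Laplacian and the time
derivative of the heat kernel. -/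
noncomputable def heatLaplaceKernel (t : ℝ) (z : E) : ℝ :=
  (‖z‖ ^ 2 / (4 * t ^ 2) - (finrank ℝ E : ℝ) / (2 * t)) * heatKernel t z

theorem heatKernel_pos {t : ℝ} (ht : 0 < t) (z : E) : 0 < heatKernel t z := by
  unfold heatKernel; positivity

theorem heatKernel_neg (t : ℝ) (z : E) : heatKernel t (-z) = heatKernel t z := by
  simp [heatKernel]

theorem heatGradKernel_neg (t : ℝ) (z : E) : heatGradKernel t (-z) = -heatGradKernel t z := by
  simp [heatGradKernel, heatKernel_neg]

theorem continuous_heatKernel (t : ℝ) : Continuous (heatKernel t : E → ℝ) := by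
  unfold heatKernel; fun_prop

theorem continuous_heatGradKernel (t : ℝ) : Continuous (heatGradKernel t : E → E) :=
  ((continuous_heatKernel t).div_const _).smul continuous_id

theorem continuous_heatLaplaceKernel (t : ℝ) : Continuous (heatLaplaceKernel t : E → ℝ) :=
  (by fun_prop : Continuous fun z : E => ‖z‖ ^ 2 / (4 * t ^ 2) - (finrank ℝ E : ℝ) / (2 * t)).mul
    (continuous_heatKernel t)

theorem norm_heatGradKernel {t : ℝ} (ht : 0 < t) (z : E) :
    ‖heatGradKernel t z‖ = heatKernel t z / (2 * t) * ‖z‖ := by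
  have := heatKernel_pos ht z
  rw [heatGradKernel, norm_smul, Real.norm_of_nonneg (by positivity)]

/-- Completing the square in a product of heat kernels. -/
theorem heatKernel_mul_heatKernel {t r : ℝ} (ht : 0 < t) (hr : 0 < r) (z w : E) :
    heatKernel t ((t / (t + r)) • z + w) * heatKernel r ((r / (t + r)) • z - w) =
      heatKernel (t + r) z * heatKernel (t * r / (t + r)) w := by
  have hτ : 0 < t + r := by positivity
  have hc : (4 * Real.pi * t) * (4 * Real.pi * r) =
      (4 * Real.pi * (t + r)) * (4 * Real.pi * (t * r / (t + r))) := by field_simp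
  unfold heatKernel
  rw [mul_mul_mul_comm, mul_mul_mul_comm ((4 * Real.pi * (t + r)) ^ _),
    ← Real.mul_rpow (by positivity) (by positivity), ← Real.mul_rpow (by positivity)
    (by positivity), hc, ← Real.exp_add, ← Real.exp_add, norm_add_sq_real, norm_sub_sq_real,
    norm_smul, norm_smul, inner_smul_left, inner_smul_left, Real.norm_of_nonneg (by positivity),
    Real.norm_of_nonneg (by positivity)]
  congr 2
  simp only [conj_trivial]
  field_simp
  ring

theorem abs_heatLaplaceKernel_le {t : ℝ} (ht : 0 < t) (z : E) :
    |heatLaplaceKernel t z| ≤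
      (4 * Real.pi * t) ^ (-((finrank ℝ E : ℝ) / 2)) * ((1 + (finrank ℝ E : ℝ) / 2) / t) := by
  have hx : 0 ≤ ‖z‖ ^ 2 / (4 * t) := by positivity
  have hexp : ‖z‖ ^ 2 / (4 * t) * Real.exp (-‖z‖ ^ 2 / (4 * t)) ≤ 1 := by
    rw [neg_div, Real.exp_neg, ← div_eq_mul_inv, div_le_one (Real.exp_pos _)]
    linarith [Real.add_one_le_exp (‖z‖ ^ 2 / (4 * t))]
  have hexp' : Real.exp (-‖z‖ ^ 2 / (4 * t)) ≤ 1 := by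
    rw [Real.exp_le_one_iff, neg_div]; linarith
  have h0 : heatLaplaceKernel t z = (4 * Real.pi * t) ^ (-((finrank ℝ E : ℝ) / 2)) *
      ((‖z‖ ^ 2 / (4 * t) * Real.exp (-‖z‖ ^ 2 / (4 * t)) -
        (finrank ℝ E : ℝ) / 2 * Real.exp (-‖z‖ ^ 2 / (4 * t))) / t) := by
    unfold heatLaplaceKernel heatKernel
    field_simp
  rw [h0, abs_mul, abs_of_pos (by positivity), abs_div, abs_of_pos ht]
  gcongr
  have hp := Real.exp_pos (-‖z‖ ^ 2 / (4 * t))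
  have hd : 0 ≤ (finrank ℝ E : ℝ) / 2 := by positivity
  have h1 := mul_nonneg hx hp.le
  have h2 := mul_nonneg hd hp.le
  have h3 := mul_le_mul_of_nonneg_left hexp' hd
  rw [abs_le]
  constructor <;> linarith

theorem hasDerivAt_heatKernel {t : ℝ} (ht : 0 < t) (z : E) :
    HasDerivAt (fun t => heatKernel t z) (heatLaplaceKernel t z) t := by
  unfold heatLaplaceKernel heatKernel
  have h1 : HasDerivAt (fun t : ℝ => 4 * Real.pi * t) (4 * Real.pi) t := by
    simpa using (hasDerivAt_id t).const_mul (4 * Real.pi)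
  have h2 := h1.rpow_const (p := -((finrank ℝ E : ℝ) / 2)) (Or.inl (by positivity))
  have h3 : HasDerivAt (fun t : ℝ => -‖z‖ ^ 2 / (4 * t)) (‖z‖ ^ 2 / (4 * t ^ 2)) t := by
    have := ((hasDerivAt_id t).const_mul 4).fun_inv (by simpa using ht.ne')
    have := this.const_mul (-‖z‖ ^ 2)
    simp only [id, ← div_eq_mul_inv] at this
    refine this.congr_deriv ?_
    field_simp
  refine (h2.mul h3.exp).congr_deriv ?_
  rw [Real.rpow_sub_one (by positivity)]
  field_simp
  ring

variable (E) in
/-- A constant for the `L¹` bound of the gradient of the heat kernel. -/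
noncomputable def heatGradConst : ℝ := (1 + 2 * finrank ℝ E) / 4

variable (E) in
theorem heatGradConst_pos : 0 < heatGradConst E := by
  unfold heatGradConst; positivity

theorem norm_heatGradKernel_le {t : ℝ} (ht : 0 < t) (z : E) : ‖heatGradKernel t z‖ ≤
    (t ^ (-(1 / 2) : ℝ) / 4) * heatKernel t z +
      (t ^ (-(1 / 2) : ℝ) / (4 * t)) * (heatKernel t z * ‖z‖ ^ 2) := by
  have hG := heatKernel_pos ht z
  rw [norm_heatGradKernel ht, Real.rpow_neg ht.le, ← Real.sqrt_eq_rpow]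
  have hs : 0 < √t := Real.sqrt_pos.2 ht
  have hst : √t ^ 2 = t := Real.sq_sqrt ht.le
  have key : (2 * √t) * ‖z‖ ≤ √t ^ 2 + ‖z‖ ^ 2 := two_mul_le_add_sq _ _
  have h1 : heatKernel t z / (2 * t) * ‖z‖ =
      heatKernel t z / (4 * t * √t) * ((2 * √t) * ‖z‖) := by field_simp; ring
  have h2 : ((√t)⁻¹ / 4) * heatKernel t z + ((√t)⁻¹ / (4 * t)) * (heatKernel t z * ‖z‖ ^ 2) =
      heatKernel t z / (4 * t * √t) * (t + ‖z‖ ^ 2) := by field_simp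
  rw [h1, h2]
  rw [hst] at key
  exact mul_le_mul_of_nonneg_left key (by positivity)

variable [MeasurableSpace E] [BorelSpace E]

theorem measurable_heatKernel : Measurable fun q : ℝ × E => heatKernel q.1 q.2 := by
  unfold heatKernel; fun_prop

theorem measurable_heatLaplaceKernel : Measurable fun q : ℝ × E => heatLaplaceKernel q.1 q.2 :=
  (by fun_prop : Measurable fun q : ℝ × E =>
    ‖q.2‖ ^ 2 / (4 * q.1 ^ 2) - (finrank ℝ E : ℝ) / (2 * q.1)).mul measurable_heatKernel

variable [FiniteDimensional ℝ E]

theorem measurable_heatGradKernel : Measurable fun q : ℝ × E => heatGradKernel q.1 q.2 :=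
  (measurable_heatKernel.div (by fun_prop)).smul measurable_snd

theorem integral_heatKernel {t : ℝ} (ht : 0 < t) : ∫ z : E, heatKernel t z = 1 := by
  have h := GaussianFourier.integral_rexp_neg_mul_sq_norm (V := E)
    (show 0 < 1 / (4 * t) by positivity)
  unfold heatKernel
  rw [integral_const_mul]
  have h2 : ∀ z : E, -‖z‖ ^ 2 / (4 * t) = -(1 / (4 * t)) * ‖z‖ ^ 2 := fun z => by ring
  simp_rw [h2]
  rw [h, show Real.pi / (1 / (4 * t)) = 4 * Real.pi * t by field_simp,
    ← Real.rpow_add (by positivity), neg_add_cancel, Real.rpow_zero]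

theorem integrable_heatKernel {t : ℝ} (ht : 0 < t) : Integrable (heatKernel t : E → ℝ) := by
  by_contra h
  have := integral_heatKernel (E := E) ht
  rw [integral_undef h] at this
  exact zero_ne_one this

/-- The integral of an odd function vanishes. -/
theorem integral_eq_zero_of_odd {V : Type*} [NormedAddCommGroup V] [NormedSpace ℝ V] {k : E → V}
    (hk : ∀ z, k (-z) = -k z) : ∫ z, k z = 0 := by
  have h := integral_neg_eq_self k (volume : Measure E)
  simp_rw [hk, integral_neg] at h
  have h2 : (2 : ℝ) • ∫ z, k z = 0 := by
    rw [two_smul]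
    nth_rewrite 1 [← h]
    exact neg_add_cancel _
  exact (smul_eq_zero.1 h2).resolve_left two_ne_zero

/-- The second moment of the heat kernel. -/
theorem integral_heatKernel_mul_norm_sq [Nontrivial E] {t : ℝ} (ht : 0 < t) :
    ∫ z : E, heatKernel t z * ‖z‖ ^ 2 = 2 * finrank ℝ E * t := by
  have hd : 0 < finrank ℝ E := finrank_pos
  have hd' : (0 : ℝ) < finrank ℝ E := by exact_mod_cast hd
  set b : ℝ := 1 / (4 * t) with hb
  have hb0 : 0 < b := by positivity
  have hpow : ∀ y ∈ Set.Ioi (0 : ℝ), y ^ (finrank ℝ E - 1) = y ^ ((finrank ℝ E : ℝ) - 1) := by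
    intro y hy
    rw [← Nat.cast_pred hd, Real.rpow_natCast]
  have h0 := integral_fun_norm_addHaar (volume : Measure E)
    (fun y : ℝ => (4 * Real.pi * t) ^ (-((finrank ℝ E : ℝ) / 2)) * Real.exp (-y ^ 2 / (4 * t)))
  have h2 := integral_fun_norm_addHaar (volume : Measure E)
    (fun y : ℝ => (4 * Real.pi * t) ^ (-((finrank ℝ E : ℝ) / 2)) * Real.exp (-y ^ 2 / (4 * t)) *
      y ^ 2)
  have e0 : ∫ y in Set.Ioi (0 : ℝ), y ^ (finrank ℝ E - 1) •
      ((4 * Real.pi * t) ^ (-((finrank ℝ E : ℝ) / 2)) * Real.exp (-y ^ 2 / (4 * t))) =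
      (4 * Real.pi * t) ^ (-((finrank ℝ E : ℝ) / 2)) *
        (b ^ (-((finrank ℝ E : ℝ) - 1 + 1) / 2) * (1 / 2) *
          Real.Gamma (((finrank ℝ E : ℝ) - 1 + 1) / 2)) := by
    rw [← integral_rpow_mul_exp_neg_mul_rpow two_pos (by linarith) hb0, ← integral_const_mul]
    refine setIntegral_congr_fun measurableSet_Ioi fun y hy => ?_
    simp only [smul_eq_mul]
    rw [hpow y hy, Real.rpow_two, hb]
    ring_nf
  have e2 : ∫ y in Set.Ioi (0 : ℝ), y ^ (finrank ℝ E - 1) •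
      ((4 * Real.pi * t) ^ (-((finrank ℝ E : ℝ) / 2)) * Real.exp (-y ^ 2 / (4 * t)) * y ^ 2) =
      (4 * Real.pi * t) ^ (-((finrank ℝ E : ℝ) / 2)) *
        (b ^ (-((finrank ℝ E : ℝ) + 1 + 1) / 2) * (1 / 2) *
          Real.Gamma (((finrank ℝ E : ℝ) + 1 + 1) / 2)) := by
    rw [← integral_rpow_mul_exp_neg_mul_rpow two_pos (by linarith) hb0, ← integral_const_mul]
    refine setIntegral_congr_fun measurableSet_Ioi fun y hy => ?_
    have hy0 : (0 : ℝ) < y := hy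
    simp only [smul_eq_mul]
    rw [hpow y hy, Real.rpow_two, hb, show (finrank ℝ E : ℝ) + 1 = (finrank ℝ E : ℝ) - 1 + 2 by
      ring, Real.rpow_add hy0, Real.rpow_two]
    ring_nf
  rw [e0] at h0
  rw [e2] at h2
  have h1 := integral_heatKernel (E := E) ht
  unfold heatKernel at h1 ⊢
  rw [h1] at h0
  rw [h2]
  have hg : Real.Gamma (((finrank ℝ E : ℝ) + 1 + 1) / 2) = (finrank ℝ E : ℝ) / 2 *
      Real.Gamma (((finrank ℝ E : ℝ) - 1 + 1) / 2) := by
    rw [← sub_add_cancel (((finrank ℝ E : ℝ) + 1 + 1) / 2) 1, Real.Gamma_add_one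
      (by linarith)]
    ring_nf
  have hbp : b ^ (-((finrank ℝ E : ℝ) + 1 + 1) / 2) =
      b ^ (-((finrank ℝ E : ℝ) - 1 + 1) / 2) * (4 * t) := by
    rw [show -((finrank ℝ E : ℝ) + 1 + 1) / 2 = -((finrank ℝ E : ℝ) - 1 + 1) / 2 - 1 by ring,
      Real.rpow_sub_one hb0.ne', hb]
    field_simp
  rw [hg, hbp]
  simp only [nsmul_eq_mul, smul_eq_mul] at h0 ⊢
  linear_combination (-2 * t * (finrank ℝ E : ℝ)) * h0

theorem integrable_heatKernel_mul_norm_sq [Nontrivial E] {t : ℝ} (ht : 0 < t) :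
    Integrable fun z : E => heatKernel t z * ‖z‖ ^ 2 := by
  by_contra h
  have h1 := integral_heatKernel_mul_norm_sq (E := E) ht
  have hd : (0 : ℝ) < finrank ℝ E := by exact_mod_cast finrank_pos
  rw [integral_undef h] at h1
  have : 0 < 2 * (finrank ℝ E : ℝ) * t := by positivity
  linarith

theorem integrable_heatGradKernel [Nontrivial E] {t : ℝ} (ht : 0 < t) :
    Integrable (heatGradKernel t : E → E) :=
  (((integrable_heatKernel ht).const_mul _).add
    ((integrable_heatKernel_mul_norm_sq ht).const_mul _)).mono'
    (continuous_heatGradKernel t).aestronglyMeasurable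
    (ae_of_all _ fun z => norm_heatGradKernel_le ht z)

theorem integral_norm_heatGradKernel_le [Nontrivial E] {t : ℝ} (ht : 0 < t) :
    ∫ z : E, ‖heatGradKernel t z‖ ≤ heatGradConst E * t ^ (-(1 / 2) : ℝ) := by
  have i1 := (integrable_heatKernel (E := E) ht).const_mul (t ^ (-(1 / 2) : ℝ) / 4)
  have i2 := (integrable_heatKernel_mul_norm_sq (E := E) ht).const_mul
    (t ^ (-(1 / 2) : ℝ) / (4 * t))
  refine (integral_mono (integrable_heatGradKernel ht).norm (i1.add i2)
    (norm_heatGradKernel_le ht)).trans_eq ?_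
  simp only [Pi.add_apply]
  rw [integral_add i1 i2, integral_const_mul, integral_const_mul, integral_heatKernel ht,
    integral_heatKernel_mul_norm_sq ht]
  unfold heatGradConst
  field_simp

theorem integral_norm_heatGradKernel_mul_norm [Nontrivial E] {t : ℝ} (ht : 0 < t) :
    ∫ z : E, ‖heatGradKernel t z‖ * ‖z‖ = finrank ℝ E := by
  have : ∀ z : E, ‖heatGradKernel t z‖ * ‖z‖ = 1 / (2 * t) * (heatKernel t z * ‖z‖ ^ 2) := by
    intro z
    rw [norm_heatGradKernel ht]
    ring
  simp_rw [this]
  rw [integral_const_mul, integral_heatKernel_mul_norm_sq ht]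
  field_simp

theorem integrable_norm_heatGradKernel_mul_norm [Nontrivial E] {t : ℝ} (ht : 0 < t) :
    Integrable fun z : E => ‖heatGradKernel t z‖ * ‖z‖ := by
  have : (fun z : E => ‖heatGradKernel t z‖ * ‖z‖) =
      fun z => 1 / (2 * t) * (heatKernel t z * ‖z‖ ^ 2) := by
    ext z
    rw [norm_heatGradKernel ht]
    ring
  rw [this]
  exact (integrable_heatKernel_mul_norm_sq ht).const_mul _

theorem integral_heatGradKernel (t : ℝ) : ∫ z : E, heatGradKernel t z = 0 :=
  integral_eq_zero_of_odd (heatGradKernel_neg t)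

theorem integrable_heatKernel_smul [Nontrivial E] {t : ℝ} (ht : 0 < t) :
    Integrable fun z : E => heatKernel t z • z := by
  have : (fun z : E => heatKernel t z • z) = fun z => (2 * t) • heatGradKernel t z := by
    ext z
    rw [heatGradKernel, smul_smul]
    congr 1
    field_simp
  rw [this]
  exact (integrable_heatGradKernel ht).smul _

theorem integral_heatKernel_smul (t : ℝ) : ∫ z : E, heatKernel t z • z = 0 :=
  integral_eq_zero_of_odd fun z => by simp [heatKernel_neg]

theorem integral_heatKernel_smul_heatGradKernel [Nontrivial E] {t r : ℝ} (ht : 0 < t) (hr : 0 < r)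
    (z : E) : ∫ y, heatKernel t y • heatGradKernel r (z - y) = heatGradKernel (t + r) z := by
  have hτ : 0 < t + r := by positivity
  have hσ : 0 < t * r / (t + r) := by positivity
  rw [← integral_add_left_eq_self _ ((t / (t + r)) • z)]
  have h : ∀ w : E, heatKernel t ((t / (t + r)) • z + w) •
      heatGradKernel r (z - ((t / (t + r)) • z + w)) =
      (heatKernel (t * r / (t + r)) w) • ((heatKernel (t + r) z / (2 * (t + r))) • z) -
        (heatKernel (t + r) z / (2 * r)) • (heatKernel (t * r / (t + r)) w • w) := by
    intro w
    have hz : z - ((t / (t + r)) • z + w) = (r / (t + r)) • z - w := by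
      have : (r / (t + r)) = 1 - t / (t + r) := by field_simp; ring
      rw [this, sub_smul, one_smul]
      abel
    rw [hz, heatGradKernel, smul_smul, mul_div_assoc', heatKernel_mul_heatKernel ht hr, smul_sub,
      smul_smul, smul_smul, smul_smul]
    congr 2
    · field_simp
    · ring
  simp_rw [h]
  have i2 : Integrable fun w : E => (heatKernel (t + r) z / (2 * r)) •
      (heatKernel (t * r / (t + r)) w • w) := (integrable_heatKernel_smul hσ).smul _
  rw [integral_sub ((integrable_heatKernel hσ).smul_const _) i2, integral_smul_const, integral_smul,
    integral_heatKernel hσ, integral_heatKernel_smul, one_smul, smul_zero, sub_zero, heatGradKernel]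

theorem integral_inner_heatGradKernel [Nontrivial E] {t r : ℝ} (ht : 0 < t) (hr : 0 < r)
    (z : E) : ∫ y, inner ℝ (heatGradKernel t y) (heatGradKernel r (z - y)) =
      heatLaplaceKernel (t + r) z := by
  have hτ : 0 < t + r := by positivity
  have hσ : 0 < t * r / (t + r) := by positivity
  rw [← integral_add_left_eq_self _ ((t / (t + r)) • z)]
  have h : ∀ w : E, inner ℝ (heatGradKernel t ((t / (t + r)) • z + w))
      (heatGradKernel r (z - ((t / (t + r)) • z + w))) =
      (heatKernel (t + r) z * (‖z‖ ^ 2 / (4 * (t + r) ^ 2))) * heatKernel (t * r / (t + r)) w +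
        ((heatKernel (t + r) z * ((r - t) / (4 * t * r * (t + r)))) *
          inner ℝ z (heatKernel (t * r / (t + r)) w • w) -
        (heatKernel (t + r) z / (4 * t * r)) * (heatKernel (t * r / (t + r)) w * ‖w‖ ^ 2)) := by
    intro w
    have hz : z - ((t / (t + r)) • z + w) = (r / (t + r)) • z - w := by
      have : (r / (t + r)) = 1 - t / (t + r) := by field_simp; ring
      rw [this, sub_smul, one_smul]
      abel
    have hG := heatKernel_mul_heatKernel ht hr z w
    rw [hz, heatGradKernel, heatGradKernel, inner_smul_left, inner_smul_right]
    simp only [inner_sub_right, inner_add_left, inner_smul_left, inner_smul_right, conj_trivial,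
      real_inner_self_eq_norm_sq, real_inner_comm z w]
    calc _ = (heatKernel t ((t / (t + r)) • z + w) * heatKernel r ((r / (t + r)) • z - w)) /
          (4 * t * r) * (t * r / (t + r) ^ 2 * ‖z‖ ^ 2 + (r - t) / (t + r) * inner ℝ z w
            - ‖w‖ ^ 2) := by
          field_simp
          ring
      _ = _ := by
          rw [hG]
          field_simp
          ring
  simp_rw [h]
  have i1 := (integrable_heatKernel (E := E) hσ).const_mul
    (heatKernel (t + r) z * (‖z‖ ^ 2 / (4 * (t + r) ^ 2)))
  have i2 := ((integrable_heatKernel_smul (E := E) hσ).const_inner (𝕜 := ℝ) z).const_mul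
    (heatKernel (t + r) z * ((r - t) / (4 * t * r * (t + r))))
  have i3 := (integrable_heatKernel_mul_norm_sq (E := E) hσ).const_mul
    (heatKernel (t + r) z / (4 * t * r))
  have i4 : Integrable fun w : E => (heatKernel (t + r) z * ((r - t) / (4 * t * r * (t + r)))) *
      inner ℝ z (heatKernel (t * r / (t + r)) w • w) -
        (heatKernel (t + r) z / (4 * t * r)) * (heatKernel (t * r / (t + r)) w * ‖w‖ ^ 2) :=
    i2.sub i3
  rw [integral_add i1 i4, integral_sub i2 i3, integral_const_mul, integral_const_mul,
    integral_const_mul, integral_inner (integrable_heatKernel_smul hσ), integral_heatKernel hσ,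
    integral_heatKernel_smul, integral_heatKernel_mul_norm_sq hσ, inner_zero_right]
  unfold heatLaplaceKernel
  field_simp
  ring

end HeatKernel

/-! ### The heat flow of compactly supported Lipschitz functions -/

section HeatFlow

open Module

/-- Compactly supported Lipschitz functions. This class contains the test functions, and it has all
the regularity that the estimates below need. -/
structure IsCompactLipschitz {E : Type*} [NormedAddCommGroup E] (f : E → ℝ) : Prop where
  hasCompactSupport : HasCompactSupport f
  exists_lipschitzWith : ∃ K, LipschitzWith K f

namespace IsCompactLipschitz

variable {E : Type*} [NormedAddCommGroup E] {f g : E → ℝ}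

theorem continuous (hf : IsCompactLipschitz f) : Continuous f :=
  hf.exists_lipschitzWith.choose_spec.continuous

theorem sub (hf : IsCompactLipschitz f) (hg : IsCompactLipschitz g) :
    IsCompactLipschitz fun x => f x - g x := by
  obtain ⟨K, hK⟩ := hf.exists_lipschitzWith
  obtain ⟨K', hK'⟩ := hg.exists_lipschitzWith
  exact ⟨hf.hasCompactSupport.sub hg.hasCompactSupport, _, hK.sub hK'⟩

theorem exists_bound (hf : IsCompactLipschitz f) :
    ∃ M : ℝ, 0 ≤ M ∧ (∀ x, |f x| ≤ M) ∧ ∀ x z, |f (x + z) - f x| ≤ M * ‖z‖ := by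
  obtain ⟨K, hK⟩ := hf.exists_lipschitzWith
  obtain ⟨M, hM⟩ := hf.continuous.bounded_above_of_compact_support hf.hasCompactSupport
  refine ⟨max M K, le_max_of_le_right K.2, fun x => (hM x).trans (le_max_left _ _), fun x z => ?_⟩
  have := hK.dist_le_mul (x + z) x
  rw [Real.dist_eq, dist_eq_norm, add_sub_cancel_left] at this
  exact this.trans (mul_le_mul_of_nonneg_right (le_max_right _ _) (norm_nonneg _))

theorem integrable [MeasurableSpace E] [BorelSpace E] {μ : Measure E}
    [IsFiniteMeasureOnCompacts μ] (hf : IsCompactLipschitz f) : Integrable f μ :=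
  hf.continuous.integrable_of_hasCompactSupport hf.hasCompactSupport

end IsCompactLipschitz

variable {E : Type*} [NormedAddCommGroup E] [InnerProductSpace ℝ E] [FiniteDimensional ℝ E]
  [MeasurableSpace E] [BorelSpace E]

/-- The heat flow `P_t f`. -/
noncomputable def heatFlow (t : ℝ) (f : E → ℝ) (x : E) : ℝ := ∫ z, f (x + z) * heatKernel t z

/-- The gradient of the heat flow of `f`, with all derivatives on the kernel. -/
noncomputable def heatGrad (t : ℝ) (f : E → ℝ) (x : E) : E :=
  ∫ z, f (x + z) • heatGradKernel t z

/-- The Laplacian of the heat flow of `f`, with all derivatives on the kernel. -/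
noncomputable def heatLaplace (t : ℝ) (f : E → ℝ) (x : E) : ℝ :=
  ∫ z, f (x + z) * heatLaplaceKernel t z

variable {f : E → ℝ}

theorem IsCompactLipschitz.integrable_smul {V : Type*} [NormedAddCommGroup V] [NormedSpace ℝ V]
    (hf : IsCompactLipschitz f) {k : E → V} (hk : Integrable k) (x : E) :
    Integrable fun z => f (x + z) • k z := by
  obtain ⟨M, -, hM, -⟩ := hf.exists_bound
  exact hk.bdd_smul M (hf.continuous.comp (continuous_const_add x)).aestronglyMeasurable
    (ae_of_all _ fun z => hM _)

theorem stronglyMeasurable_heatGrad (hf : Continuous f) :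
    StronglyMeasurable fun q : ℝ × E => heatGrad q.1 f q.2 := by
  unfold heatGrad
  refine StronglyMeasurable.integral_prod_right (f := fun (q : ℝ × E) (z : E) =>
    f (q.2 + z) • heatGradKernel q.1 z) (Measurable.stronglyMeasurable ?_)
  exact (hf.measurable.comp (by fun_prop)).smul (measurable_heatGradKernel.comp
    ((measurable_fst.comp measurable_fst).prodMk measurable_snd))

theorem stronglyMeasurable_heatLaplace (hf : Continuous f) :
    StronglyMeasurable fun q : ℝ × E => heatLaplace q.1 f q.2 := by
  unfold heatLaplace
  refine StronglyMeasurable.integral_prod_right (f := fun (q : ℝ × E) (z : E) =>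
    f (q.2 + z) * heatLaplaceKernel q.1 z) (Measurable.stronglyMeasurable ?_)
  have h1 : Measurable fun q : (ℝ × E) × E => f (q.1.2 + q.2) :=
    hf.measurable.comp (by fun_prop)
  have h2 : Measurable fun q : (ℝ × E) × E => heatLaplaceKernel q.1.1 q.2 :=
    (measurable_heatLaplaceKernel (E := E)).comp
      (g := fun q : ℝ × E => heatLaplaceKernel q.1 q.2) (f := fun q : (ℝ × E) × E => (q.1.1, q.2))
      ((measurable_fst.comp measurable_fst).prodMk measurable_snd)
  exact Measurable.mul h1 h2

/-- As the gradient of the heat kernel has mean zero, `f` may be replaced by its increments. -/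
theorem heatGrad_eq_integral_sub [Nontrivial E] (hf : IsCompactLipschitz f) {t : ℝ} (ht : 0 < t)
    (x : E) : heatGrad t f x = ∫ z, (f (x + z) - f x) • heatGradKernel t z := by
  have hi : Integrable fun z : E => f x • heatGradKernel t z :=
    (integrable_heatGradKernel ht).smul (f x)
  simp_rw [sub_smul]
  rw [integral_sub (hf.integrable_smul (integrable_heatGradKernel ht) x) hi, integral_smul, integral_heatGradKernel, smul_zero,
    sub_zero, heatGrad]

theorem exists_integral_norm_sub_smul_heatGradKernel_le [Nontrivial E] (hf : IsCompactLipschitz f) :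
    ∃ C : ℝ, 0 ≤ C ∧ ∀ t : ℝ, 0 < t → ∀ x,
      ∫ z, ‖(f (x + z) - f x) • heatGradKernel t z‖ ≤ C * min 1 (t ^ (-(1 / 2) : ℝ)) := by
  obtain ⟨M, hM0, hM, hL⟩ := hf.exists_bound
  have hc := heatGradConst_pos E
  refine ⟨max (M * finrank ℝ E) (2 * M * heatGradConst E), le_max_of_le_right (by positivity),
    fun t ht x => ?_⟩
  have ht' : 0 ≤ t ^ (-(1 / 2) : ℝ) := by positivity
  have h1 : ∫ z, ‖(f (x + z) - f x) • heatGradKernel t z‖ ≤ M * finrank ℝ E := by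
    rw [← integral_norm_heatGradKernel_mul_norm ht, ← integral_const_mul]
    refine integral_mono_of_nonneg (ae_of_all _ fun z => norm_nonneg _)
      ((integrable_norm_heatGradKernel_mul_norm ht).const_mul M) (ae_of_all _ fun z => ?_)
    simp only
    rw [norm_smul, mul_comm ‖heatGradKernel t z‖, ← mul_assoc]
    exact mul_le_mul_of_nonneg_right (hL x z) (norm_nonneg _)
  have h2 : ∫ z, ‖(f (x + z) - f x) • heatGradKernel t z‖ ≤
      2 * M * heatGradConst E * t ^ (-(1 / 2) : ℝ) := by
    rw [mul_assoc]
    refine le_trans ?_ (mul_le_mul_of_nonneg_left (integral_norm_heatGradKernel_le ht)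
      (by positivity : 0 ≤ 2 * M))
    rw [← integral_const_mul]
    refine integral_mono_of_nonneg (ae_of_all _ fun z => norm_nonneg _)
      ((integrable_heatGradKernel ht).norm.const_mul (2 * M)) (ae_of_all _ fun z => ?_)
    simp only
    rw [norm_smul]
    refine mul_le_mul_of_nonneg_right ?_ (norm_nonneg _)
    calc ‖f (x + z) - f x‖ ≤ |f (x + z)| + |f x| := abs_sub _ _
      _ ≤ 2 * M := by linarith [hM (x + z), hM x]
  rw [mul_min_of_nonneg _ _ (le_max_of_le_right (by positivity)), mul_one]
  exact le_min (h1.trans (le_max_left _ _))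
    (h2.trans (mul_le_mul_of_nonneg_right (le_max_right _ _) ht'))

theorem exists_norm_heatGrad_le [Nontrivial E] (hf : IsCompactLipschitz f) :
    ∃ C : ℝ, 0 ≤ C ∧ ∀ t : ℝ, 0 < t → ∀ x, ‖heatGrad t f x‖ ≤ C * min 1 (t ^ (-(1 / 2) : ℝ)) := by
  obtain ⟨C, hC0, hC⟩ := exists_integral_norm_sub_smul_heatGradKernel_le hf
  refine ⟨C, hC0, fun t ht x => ?_⟩
  rw [heatGrad_eq_integral_sub hf ht]
  exact (norm_integral_le_integral_norm _).trans (hC t ht x)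

/-- Composition of two kernel operators, in terms of the convolution of the kernels. -/
theorem integral_bilin_integral_translate {V₁ V₂ V₃ : Type*} [NormedAddCommGroup V₁]
    [NormedSpace ℝ V₁] [NormedAddCommGroup V₂] [NormedSpace ℝ V₂] [CompleteSpace V₂]
    [NormedAddCommGroup V₃] [NormedSpace ℝ V₃] [CompleteSpace V₃] (B : V₁ →L[ℝ] V₂ →L[ℝ] V₃)
    {k₁ : E → V₁} {k₂ : E → V₂} (h₁ : Integrable k₁) (h₂ : Integrable k₂)
    (hf : IsCompactLipschitz f) (x : E) :
    ∫ y, B (k₁ y) (∫ z, f (x + y + z) • k₂ z) = ∫ z, f (x + z) • ∫ y, B (k₁ y) (k₂ (z - y)) := by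
  obtain ⟨M, -, hM, -⟩ := hf.exists_bound
  have hint : Integrable (fun q : E × E => f (x + q.1) • B (k₁ q.2) (k₂ (q.1 - q.2)))
      (volume.prod volume) :=
    (h₁.convolution_integrand B h₂).bdd_smul M
      (hf.continuous.comp (by fun_prop : Continuous fun q : E × E => x + q.1)).aestronglyMeasurable
      (ae_of_all _ fun z => hM _)
  calc ∫ y, B (k₁ y) (∫ z, f (x + y + z) • k₂ z)
      = ∫ y, ∫ z, f (x + z) • B (k₁ y) (k₂ (z - y)) := by
        refine integral_congr_ae (ae_of_all _ fun y => ?_)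
        simp only
        rw [← ContinuousLinearMap.integral_comp_comm _ (hf.integrable_smul h₂ (x + y)),
          ← integral_sub_right_eq_self _ y]
        refine integral_congr_ae (ae_of_all _ fun z => ?_)
        simp [add_assoc]
    _ = ∫ z, ∫ y, f (x + z) • B (k₁ y) (k₂ (z - y)) := (integral_integral_swap hint).symm
    _ = _ := by simp_rw [integral_smul]

theorem integral_heatKernel_smul_heatGrad [Nontrivial E] (hf : IsCompactLipschitz f) {t r : ℝ}
    (ht : 0 < t) (hr : 0 < r) (x : E) :
    ∫ y, heatKernel t y • heatGrad r f (x + y) = heatGrad (t + r) f x := by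
  have h := integral_bilin_integral_translate (ContinuousLinearMap.lsmul ℝ ℝ)
    (integrable_heatKernel ht) (integrable_heatGradKernel hr) hf x
  simp only [ContinuousLinearMap.lsmul_apply] at h
  simp_rw [integral_heatKernel_smul_heatGradKernel ht hr] at h
  exact h

theorem integral_inner_heatGrad [Nontrivial E] (hf : IsCompactLipschitz f) {t r : ℝ}
    (ht : 0 < t) (hr : 0 < r) (x : E) :
    ∫ y, inner ℝ (heatGradKernel t y) (heatGrad r f (x + y)) = heatLaplace (t + r) f x := by
  have h := integral_bilin_integral_translate (innerSL ℝ)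
    (integrable_heatGradKernel ht) (integrable_heatGradKernel hr) hf x
  change ∫ y, inner ℝ (heatGradKernel t y) (heatGrad r f (x + y)) =
    ∫ z, f (x + z) • ∫ y, inner ℝ (heatGradKernel t y) (heatGradKernel r (z - y)) at h
  simp_rw [integral_inner_heatGradKernel ht hr] at h
  exact h

/-- Half of the derivatives of the heat kernel suffice to regularize, the other half is absorbed by
the Lipschitz function. -/
theorem exists_abs_heatLaplace_le [Nontrivial E] (hf : IsCompactLipschitz f) :
    ∃ C : ℝ, 0 ≤ C ∧ ∀ t : ℝ, 0 < t → ∀ x, |heatLaplace t f x| ≤ C * t ^ (-(1 / 2) : ℝ) := by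
  obtain ⟨C, hC0, hC⟩ := exists_norm_heatGrad_le hf
  have hc := heatGradConst_pos E
  refine ⟨heatGradConst E * (1 / 2 : ℝ) ^ (-(1 / 2) : ℝ) * C, by positivity, fun t ht x => ?_⟩
  have ht2 : 0 < 1 / 2 * t := by positivity
  have h := integral_inner_heatGrad hf ht2 ht2 x
  rw [show 1 / 2 * t + 1 / 2 * t = t by ring] at h
  rw [← h, ← Real.norm_eq_abs]
  calc ‖∫ y, inner ℝ (heatGradKernel (1 / 2 * t) y) (heatGrad (1 / 2 * t) f (x + y))‖
      ≤ ∫ y : E, ‖heatGradKernel (1 / 2 * t) y‖ * C := by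
        refine norm_integral_le_of_norm_le ((integrable_heatGradKernel ht2).norm.mul_const C)
          (ae_of_all _ fun y => (norm_inner_le_norm _ _).trans ?_)
        refine mul_le_mul_of_nonneg_left ((hC _ ht2 _).trans ?_) (norm_nonneg _)
        exact mul_le_of_le_one_right hC0 (min_le_left _ _)
    _ ≤ heatGradConst E * (1 / 2 * t) ^ (-(1 / 2) : ℝ) * C := by
        rw [integral_mul_const]
        exact mul_le_mul_of_nonneg_right (integral_norm_heatGradKernel_le ht2) hC0
    _ = _ := by
        rw [Real.mul_rpow (by norm_num) ht.le]
        ring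

variable (E) in
/-- A constant for the decay of the Laplacian of the heat flow. -/
noncomputable def heatLaplaceConst : ℝ :=
  (4 * Real.pi) ^ (-((finrank ℝ E : ℝ) / 2)) * (1 + (finrank ℝ E : ℝ) / 2)

theorem abs_heatLaplace_le (hf : IsCompactLipschitz f) {t : ℝ} (ht : 0 < t) (x : E) :
    |heatLaplace t f x| ≤
      heatLaplaceConst E * t ^ (-((finrank ℝ E : ℝ) / 2) - 1) * ∫ z, |f (x + z)| := by
  have hi : Integrable fun z => |f (x + z)| := (hf.integrable.comp_add_left x).abs
  rw [← integral_const_mul, ← Real.norm_eq_abs]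
  refine norm_integral_le_of_norm_le (hi.const_mul _) (ae_of_all _ fun z => ?_)
  rw [norm_mul, Real.norm_eq_abs, Real.norm_eq_abs, mul_comm |f (x + z)|]
  refine mul_le_mul_of_nonneg_right ((abs_heatLaplaceKernel_le ht z).trans_eq ?_) (abs_nonneg _)
  rw [Real.mul_rpow (by positivity) ht.le, Real.rpow_sub_one ht.ne', heatLaplaceConst]
  ring

theorem integrableOn_heatLaplace [Nontrivial E] (hf : IsCompactLipschitz f) (x : E) :
    IntegrableOn (fun t => heatLaplace t f x) (Set.Ioi 0) := by
  have hm : StronglyMeasurable fun t => heatLaplace t f x :=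
    (stronglyMeasurable_heatLaplace hf.continuous).comp_measurable
      (measurable_id.prodMk measurable_const)
  have hd : (0 : ℝ) < finrank ℝ E := by exact_mod_cast finrank_pos
  obtain ⟨C, hC0, hC⟩ := exists_abs_heatLaplace_le hf
  rw [← Set.Ioc_union_Ioi_eq_Ioi zero_le_one]
  refine IntegrableOn.union ?_ ?_
  · have hi : IntervalIntegrable (fun t : ℝ => t ^ (-(1 / 2) : ℝ)) volume 0 1 :=
      intervalIntegral.intervalIntegrable_rpow' (by norm_num)
    rw [intervalIntegrable_iff_integrableOn_Ioc_of_le zero_le_one] at hi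
    refine Integrable.mono' (hi.const_mul C) hm.aestronglyMeasurable ?_
    filter_upwards [ae_restrict_mem measurableSet_Ioc] with t ht using hC t ht.1 x
  · have hi := integrableOn_Ioi_rpow_of_lt
      (show -((finrank ℝ E : ℝ) / 2) - 1 < -1 by linarith) one_pos
    refine Integrable.mono' ((hi.const_mul (heatLaplaceConst E)).mul_const (∫ z, |f (x + z)|))
      hm.aestronglyMeasurable ?_
    filter_upwards [ae_restrict_mem measurableSet_Ioi] with t ht
      using abs_heatLaplace_le hf (one_pos.trans ht) x

theorem hasDerivAt_heatFlow (hf : IsCompactLipschitz f) {t : ℝ} (ht : 0 < t)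
    (x : E) : HasDerivAt (fun t => heatFlow t f x) (heatLaplace t f x) t := by
  have hi : Integrable fun z => |f (x + z)| := (hf.integrable.comp_add_left x).abs
  have hfc : Continuous fun z => f (x + z) := hf.continuous.comp (continuous_const_add x)
  refine (hasDerivAt_integral_of_dominated_loc_of_deriv_le
    (F := fun t z => f (x + z) * heatKernel t z) (F' := fun t z => f (x + z) * heatLaplaceKernel t z)
    (bound := fun z => |f (x + z)| *
      ((4 * Real.pi * (t / 2)) ^ (-((finrank ℝ E : ℝ) / 2)) *
        ((1 + (finrank ℝ E : ℝ) / 2) / (t / 2))))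
    (Ioi_mem_nhds (show t / 2 < t by linarith)) ?_ ?_ ?_ ?_ (hi.mul_const _) ?_).2
  · exact .of_forall fun t => (hfc.mul (continuous_heatKernel t)).aestronglyMeasurable
  · exact hf.integrable_smul (integrable_heatKernel ht) x
  · exact (hfc.mul (continuous_heatLaplaceKernel t)).aestronglyMeasurable
  · refine ae_of_all _ fun z s hs => ?_
    have hs' : t / 2 < s := hs
    have hs0 : 0 < s := by linarith
    rw [norm_mul, Real.norm_eq_abs, Real.norm_eq_abs]
    refine mul_le_mul_of_nonneg_left ((abs_heatLaplaceKernel_le hs0 z).trans ?_) (abs_nonneg _)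
    have : (4 * Real.pi * s) ^ (-((finrank ℝ E : ℝ) / 2)) ≤
        (4 * Real.pi * (t / 2)) ^ (-((finrank ℝ E : ℝ) / 2)) := by
      refine Real.rpow_le_rpow_of_nonpos (by positivity) (by gcongr) ?_
      rw [neg_nonpos]
      positivity
    gcongr
  · refine ae_of_all _ fun z s hs => ?_
    have hs' : t / 2 < s := hs
    exact (hasDerivAt_heatKernel (by linarith) z).const_mul _

theorem exists_abs_heatFlow_sub_le [Nontrivial E] (hf : IsCompactLipschitz f) :
    ∃ C : ℝ, ∀ t : ℝ, 0 < t → ∀ x, |heatFlow t f x - f x| ≤ C * t ^ (1 / 2 : ℝ) := by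
  obtain ⟨M, hM0, hM, hL⟩ := hf.exists_bound
  refine ⟨M * (2 * heatGradConst E), fun t ht x => ?_⟩
  have hk := integrable_heatKernel (E := E) ht
  have h1 : heatFlow t f x - f x = ∫ z, (f (x + z) - f x) * heatKernel t z := by
    simp_rw [sub_mul]
    have hi : Integrable fun z => f (x + z) * heatKernel t z := hf.integrable_smul hk x
    rw [integral_sub hi (hk.const_mul _), integral_const_mul,
      integral_heatKernel ht, mul_one, heatFlow]
  have h2 : ∀ z : E, |(f (x + z) - f x) * heatKernel t z| ≤ M * (2 * t) * ‖heatGradKernel t z‖ := by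
    intro z
    have hG := heatKernel_pos ht z
    rw [norm_heatGradKernel ht, abs_mul, abs_of_pos hG]
    calc |f (x + z) - f x| * heatKernel t z ≤ M * ‖z‖ * heatKernel t z :=
          mul_le_mul_of_nonneg_right (hL x z) hG.le
      _ = _ := by field_simp
  rw [h1, ← Real.norm_eq_abs]
  refine (norm_integral_le_of_norm_le ((integrable_heatGradKernel ht).norm.const_mul _)
    (ae_of_all _ h2)).trans ?_
  rw [integral_const_mul]
  refine (mul_le_mul_of_nonneg_left (integral_norm_heatGradKernel_le ht) (by positivity)).trans_eq ?_
  have : t ^ (1 / 2 : ℝ) = t * t ^ (-(1 / 2) : ℝ) := by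
    nth_rewrite 2 [← Real.rpow_one t]
    rw [← Real.rpow_add ht]
    norm_num
  rw [this]
  ring

theorem tendsto_heatFlow_atTop [Nontrivial E] (hf : IsCompactLipschitz f) (x : E) :
    Tendsto (fun t => heatFlow t f x) atTop (𝓝 0) := by
  have hd : (0 : ℝ) < finrank ℝ E := by exact_mod_cast finrank_pos
  have h1 : Tendsto (fun t : ℝ => (4 * Real.pi * t) ^ (-((finrank ℝ E : ℝ) / 2)) *
      ∫ z, |f (x + z)|) atTop (𝓝 0) := by
    rw [← zero_mul (∫ z, |f (x + z)|)]
    refine Tendsto.mul_const _ ((tendsto_rpow_neg_atTop (half_pos hd)).comp ?_)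
    exact tendsto_id.const_mul_atTop (by positivity)
  refine squeeze_zero_norm' ?_ h1
  filter_upwards [eventually_gt_atTop 0] with t ht
  rw [← integral_const_mul]
  refine norm_integral_le_of_norm_le (((hf.integrable.comp_add_left x).abs).const_mul _)
    (ae_of_all _ fun z => ?_)
  have hG := heatKernel_pos ht z
  rw [norm_mul, Real.norm_eq_abs, Real.norm_of_nonneg hG.le, mul_comm]
  refine mul_le_mul_of_nonneg_right ?_ (abs_nonneg _)
  unfold heatKernel
  refine mul_le_of_le_one_right (by positivity) ?_
  rw [Real.exp_le_one_iff, neg_div, neg_nonpos]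
  positivity

/-- The fundamental theorem of calculus for the heat flow, from time `0` to time `∞`. -/
theorem integral_heatLaplace [Nontrivial E] (hf : IsCompactLipschitz f) (x : E) :
    ∫ t in Set.Ioi 0, heatLaplace t f x = -f x := by
  obtain ⟨C, hC⟩ := exists_abs_heatFlow_sub_le hf
  -- The heat flow is extended by its initial value, as the kernel at time `0` is a junk value.
  set F : ℝ → ℝ := fun t => if 0 < t then heatFlow t f x else f x with hF
  have hF0 : F 0 = f x := by simp [hF]
  have hev : ∀ t > 0, F =ᶠ[𝓝 t] fun t => heatFlow t f x := fun t ht => by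
    filter_upwards [Ioi_mem_nhds ht] with s hs
    exact if_pos hs
  have h := integral_Ioi_of_hasDerivAt_of_tendsto (f := F) (f' := fun t => heatLaplace t f x)
    (a := 0) (m := 0) ?_ ?_ (integrableOn_heatLaplace hf x) ?_
  · rw [h, hF0, zero_sub]
  · rw [← continuousWithinAt_Ioi_iff_Ici, ContinuousWithinAt, hF0, tendsto_iff_norm_sub_tendsto_zero]
    have h1 : Tendsto (fun t : ℝ => C * t ^ (1 / 2 : ℝ)) (𝓝[>] 0) (𝓝 0) := by
      have : Continuous fun t : ℝ => C * t ^ (1 / 2 : ℝ) :=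
        continuous_const.mul (Real.continuous_rpow_const (by norm_num))
      have h2 := this.tendsto 0
      rw [Real.zero_rpow (by norm_num), mul_zero] at h2
      exact h2.mono_left nhdsWithin_le_nhds
    refine squeeze_zero' (.of_forall fun t => norm_nonneg _) ?_ h1
    filter_upwards [self_mem_nhdsWithin] with t ht
    have ht' : 0 < t := ht
    simpa [hF, ht'] using hC t ht' x
  · exact fun t ht => (hasDerivAt_heatFlow hf ht x).congr_of_eventuallyEq (hev t ht)
  · refine (tendsto_heatFlow_atTop hf x).congr' ?_
    filter_upwards [eventually_gt_atTop 0] with t ht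
    exact (if_pos ht).symm

end HeatFlow

/-! ### Subordination of the fractional gradient to the heat flow -/

section Subordination

open Module

theorem integral_rieszMeasure {V : Type*} [NormedAddCommGroup V] [NormedSpace ℝ V] {α : ℝ}
    (hα : 0 < α) (F : ℝ → V) :
    ∫ t, F t ∂rieszMeasure α = ∫ t in Set.Ioi 0, (t ^ (α - 1) / Real.Gamma α) • F t := by
  have hΓ := Real.Gamma_pos_of_pos hα
  have hfin : ∀ t, rieszDensity α t < ∞ := fun t => by
    rcases le_or_gt t 0 with ht | ht
    · simp [rieszDensity_of_nonpos ht]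
    · simp [rieszDensity_of_pos ht]
  rw [rieszMeasure, integral_withDensity_eq_integral_toReal_smul (measurable_rieszDensity α)
    (ae_of_all _ hfin), ← integral_indicator measurableSet_Ioi]
  refine integral_congr_ae (ae_of_all _ fun t => ?_)
  rcases le_or_gt t 0 with ht | ht
  · simp [rieszDensity_of_nonpos ht, ht]
  · simp only
    rw [rieszDensity_of_pos ht, ENNReal.toReal_ofReal (by positivity),
      Set.indicator_of_mem (Set.mem_Ioi.2 ht)]

theorem integral_rpow_mul_exp_neg_div {q A : ℝ} (hq : 0 < q) (hA : 0 < A) :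
    ∫ t in Set.Ioi (0 : ℝ), t ^ (-q - 1) * Real.exp (-A / t) = A ^ (-q) * Real.Gamma q := by
  have h := integral_comp_rpow_Ioi (fun v : ℝ => v ^ (q - 1) * Real.exp (-(A * v)))
    (show (-1 : ℝ) ≠ 0 by norm_num)
  rw [Real.integral_rpow_mul_exp_neg_mul_Ioi hq hA, one_div, Real.inv_rpow hA.le,
    ← Real.rpow_neg hA.le] at h
  rw [← h]
  refine setIntegral_congr_fun measurableSet_Ioi fun t ht => ?_
  have ht0 : (0 : ℝ) < t := ht
  simp only [smul_eq_mul]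
  rw [← Real.rpow_mul ht0.le, abs_neg, abs_one, one_mul, ← mul_assoc, ← Real.rpow_add ht0,
    Real.rpow_neg_one]
  ring_nf

variable {E : Type*} [NormedAddCommGroup E] [InnerProductSpace ℝ E] [FiniteDimensional ℝ E]

/-- The kernel of the fractional gradient is a superposition of gradients of heat kernels. -/
theorem integral_heatGradKernel_rieszMeasure {s : ℝ} (hs : -1 < s) (hs1 : s < 1) {z : E}
    (hz : z ≠ 0) : ∫ t, heatGradKernel t z ∂rieszMeasure ((1 - s) / 2) =
      (fracConst (finrank ℝ E) s / ‖z‖ ^ ((finrank ℝ E : ℝ) + s + 1)) • z := by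
  have hz' : 0 < ‖z‖ := norm_pos_iff.2 hz
  have hα : 0 < (1 - s) / 2 := by linarith
  have hq : 0 < ((finrank ℝ E : ℝ) + s + 1) / 2 := by
    have : (0 : ℝ) ≤ finrank ℝ E := by positivity
    linarith
  have hA : 0 < ‖z‖ ^ 2 / 4 := by positivity
  have hΓ := Real.Gamma_pos_of_pos hα
  unfold heatGradKernel
  rw [integral_smul_const, integral_rieszMeasure hα]
  congr 1
  have h1 : ∀ t ∈ Set.Ioi (0 : ℝ), (t ^ ((1 - s) / 2 - 1) / Real.Gamma ((1 - s) / 2)) •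
      (heatKernel t z / (2 * t)) =
      ((4 * Real.pi) ^ (-((finrank ℝ E : ℝ) / 2)) / (2 * Real.Gamma ((1 - s) / 2))) *
        (t ^ (-(((finrank ℝ E : ℝ) + s + 1) / 2) - 1) * Real.exp (-(‖z‖ ^ 2 / 4) / t)) := by
    intro t ht
    have ht0 : (0 : ℝ) < t := ht
    have e : t ^ (-(((finrank ℝ E : ℝ) + s + 1) / 2) - 1) =
        t ^ ((1 - s) / 2 - 1) * t ^ (-((finrank ℝ E : ℝ) / 2)) / t := by
      rw [← Real.rpow_add ht0, ← Real.rpow_sub_one ht0.ne']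
      ring_nf
    rw [e, heatKernel, Real.mul_rpow (by positivity) ht0.le, smul_eq_mul,
      show -(‖z‖ ^ 2 / 4) / t = -‖z‖ ^ 2 / (4 * t) by field_simp]
    field_simp
  rw [setIntegral_congr_fun measurableSet_Ioi h1, integral_const_mul,
    integral_rpow_mul_exp_neg_div hq hA]
  have e4 : (4 : ℝ) = 2 ^ (2 : ℝ) := by norm_num
  have e1 : (‖z‖ ^ 2 / 4) ^ (-(((finrank ℝ E : ℝ) + s + 1) / 2)) =
      2 ^ ((finrank ℝ E : ℝ) + s + 1) / ‖z‖ ^ ((finrank ℝ E : ℝ) + s + 1) := by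
    rw [Real.div_rpow (by positivity) (by norm_num), ← Real.rpow_natCast ‖z‖ 2,
      ← Real.rpow_mul hz'.le, e4, ← Real.rpow_mul two_pos.le, Nat.cast_two,
      show (2 : ℝ) * -(((finrank ℝ E : ℝ) + s + 1) / 2) = -((finrank ℝ E : ℝ) + s + 1) by ring,
      Real.rpow_neg hz'.le, Real.rpow_neg two_pos.le]
    field_simp
  have e2 : (4 * Real.pi) ^ (-((finrank ℝ E : ℝ) / 2)) =
      2 ^ (-(finrank ℝ E : ℝ)) * Real.pi ^ (-((finrank ℝ E : ℝ) / 2)) := by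
    rw [Real.mul_rpow (by norm_num) Real.pi_pos.le, e4, ← Real.rpow_mul two_pos.le]
    ring_nf
  have e3 : (2 : ℝ) ^ ((finrank ℝ E : ℝ) + s + 1) * 2 ^ (-(finrank ℝ E : ℝ)) = 2 ^ s * 2 := by
    rw [← Real.rpow_add two_pos, ← Real.rpow_add_one two_ne_zero]
    ring_nf
  rw [e1, e2, fracConst]
  have hp := Real.rpow_pos_of_pos hz' ((finrank ℝ E : ℝ) + s + 1)
  field_simp
  linear_combination e3

variable [MeasurableSpace E] [BorelSpace E] {f : E → ℝ}

theorem integrable_sub_smul_heatGradKernel_prod [Nontrivial E] (hf : IsCompactLipschitz f) {α : ℝ}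
    (hα : 0 < α) (hα' : α < 1 / 2) (x : E) :
    Integrable (fun q : ℝ × E => (f (x + q.2) - f x) • heatGradKernel q.1 q.2)
      ((rieszMeasure α).prod volume) := by
  obtain ⟨C, hC0, hC⟩ := exists_integral_norm_sub_smul_heatGradKernel_le hf
  have hm : Measurable fun q : ℝ × E => (f (x + q.2) - f x) • heatGradKernel q.1 q.2 :=
    ((hf.continuous.measurable.comp (by fun_prop)).sub_const _).smul measurable_heatGradKernel
  rw [integrable_prod_iff hm.aestronglyMeasurable]
  constructor
  · filter_upwards [ae_rieszMeasure_pos α] with t ht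
    have hk := integrable_heatGradKernel (E := E) ht
    simp_rw [sub_smul]
    exact (hf.integrable_smul hk x).sub (hk.smul (f x))
  · refine ((integrable_min_one_rpow_rieszMeasure hα hα').const_mul C).mono'
      hm.aestronglyMeasurable.norm.integral_prod_right' ?_
    filter_upwards [ae_rieszMeasure_pos α] with t ht
    rw [Real.norm_of_nonneg (integral_nonneg fun z => norm_nonneg _)]
    exact hC t ht x

theorem integrable_heatGrad_rieszMeasure [Nontrivial E] (hf : IsCompactLipschitz f) {α : ℝ}
    (hα : 0 < α) (hα' : α < 1 / 2) (x : E) :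
    Integrable (fun t => heatGrad t f x) (rieszMeasure α) := by
  refine (integrable_sub_smul_heatGradKernel_prod hf hα hα' x).integral_prod_left.congr ?_
  filter_upwards [ae_rieszMeasure_pos α] with t ht using (heatGrad_eq_integral_sub hf ht x).symm

/-- The fractional gradient as an absolutely convergent singular integral. -/
theorem integrable_sub_div_smul_and_integral [Nontrivial E] (hf : IsCompactLipschitz f) {s : ℝ}
    (hs : 0 < s) (hs1 : s < 1) (x : E) :
    Integrable (fun z => ((f (x + z) - f x) / ‖z‖ ^ ((finrank ℝ E : ℝ) + s + 1)) • z) ∧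
      fracConst (finrank ℝ E) s •
        ∫ z, ((f (x + z) - f x) / ‖z‖ ^ ((finrank ℝ E : ℝ) + s + 1)) • z =
      ∫ t, heatGrad t f x ∂rieszMeasure ((1 - s) / 2) := by
  have hα : 0 < (1 - s) / 2 := by linarith
  have hα' : (1 - s) / 2 < 1 / 2 := by linarith
  have hc : 0 < fracConst (finrank ℝ E) s := by
    have h1 := Real.Gamma_pos_of_pos hα
    have h2 : 0 < Real.Gamma (((finrank ℝ E : ℝ) + s + 1) / 2) :=
      Real.Gamma_pos_of_pos (by positivity)
    unfold fracConst
    positivity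
  have hint := integrable_sub_smul_heatGradKernel_prod hf hα hα' x
  have hz : ∀ᵐ z : E, ∫ t, (f (x + z) - f x) • heatGradKernel t z ∂rieszMeasure ((1 - s) / 2) =
      fracConst (finrank ℝ E) s •
        (((f (x + z) - f x) / ‖z‖ ^ ((finrank ℝ E : ℝ) + s + 1)) • z) := by
    filter_upwards [Measure.ae_ne volume (0 : E)] with z hz
    rw [integral_smul, integral_heatGradKernel_rieszMeasure (by linarith) hs1 hz, smul_smul,
      smul_smul]
    congr 1
    ring
  constructor
  · have h := hint.integral_prod_right.congr hz
    exact (integrable_fun_smul_iff hc.ne' _).1 h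
  · rw [← integral_smul, ← integral_congr_ae hz, ← integral_integral_swap hint]
    refine integral_congr_ae ?_
    filter_upwards [ae_rieszMeasure_pos ((1 - s) / 2)] with t ht
      using (heatGrad_eq_integral_sub hf ht x).symm

/-- The truncated integrals in the definition of the fractional gradient converge. -/
theorem tendsto_integral_compl_ball [Nontrivial E] (hf : IsCompactLipschitz f) {s : ℝ}
    (hs : 0 < s) (hs1 : s < 1) (x : E) :
    Tendsto (fun ε : ℝ => ∫ z in (Metric.ball (0 : E) ε)ᶜ,
      (f (x + z) / ‖z‖ ^ ((finrank ℝ E : ℝ) + s + 1)) • z) (𝓝[>] 0)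
      (𝓝 (∫ z, ((f (x + z) - f x) / ‖z‖ ^ ((finrank ℝ E : ℝ) + s + 1)) • z)) := by
  obtain ⟨hint, -⟩ := integrable_sub_div_smul_and_integral hf hs hs1 x
  have hcover : AECover (volume : Measure E) (𝓝[>] (0 : ℝ)) fun ε => (Metric.ball (0 : E) ε)ᶜ := by
    refine ⟨?_, fun ε => measurableSet_ball.compl⟩
    filter_upwards [Measure.ae_ne volume (0 : E)] with z hz
    filter_upwards [nhdsWithin_le_nhds (Iio_mem_nhds (norm_pos_iff.2 hz))] with ε hε
    simpa using le_of_lt hε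
  refine (hcover.integral_tendsto_of_countably_generated hint).congr' ?_
  filter_upwards [self_mem_nhdsWithin] with ε hε
  have hε0 : (0 : ℝ) < ε := hε
  have hmeas : MeasurableSet (Metric.ball (0 : E) ε)ᶜ := measurableSet_ball.compl
  have hd : (0 : ℝ) ≤ finrank ℝ E := by positivity
  have hi : IntegrableOn (fun z => (f (x + z) / ‖z‖ ^ ((finrank ℝ E : ℝ) + s + 1)) • z)
      (Metric.ball (0 : E) ε)ᶜ := by
    have hfi : Integrable fun z => |f (x + z)| := (hf.integrable.comp_add_left x).abs
    have hm : Measurable fun z => (f (x + z) / ‖z‖ ^ ((finrank ℝ E : ℝ) + s + 1)) • z :=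
      ((hf.continuous.measurable.comp (by fun_prop)).div (by fun_prop)).smul measurable_id
    refine Integrable.mono' (hfi.mul_const (ε ^ (-((finrank ℝ E : ℝ) + s)))).integrableOn
      hm.aestronglyMeasurable ?_
    filter_upwards [ae_restrict_mem hmeas] with z hz
    have hz1 : ε ≤ ‖z‖ := by simpa using hz
    have hz0 : 0 < ‖z‖ := hε0.trans_le hz1
    have e : ‖z‖ ^ (-((finrank ℝ E : ℝ) + s)) = ‖z‖ / ‖z‖ ^ ((finrank ℝ E : ℝ) + s + 1) := by
      rw [Real.rpow_add_one hz0.ne', Real.rpow_neg hz0.le]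
      field_simp
    rw [norm_smul, norm_div, Real.norm_eq_abs, Real.norm_of_nonneg (by positivity),
      div_mul_eq_mul_div, mul_div_assoc, ← e]
    refine mul_le_mul_of_nonneg_left ?_ (abs_nonneg _)
    exact Real.rpow_le_rpow_of_nonpos hε0 hz1 (by linarith)
  -- The integral of the odd part `f x • z / |z|^(d+s+1)` over the complement of the ball vanishes.
  have hodd : ∫ z in (Metric.ball (0 : E) ε)ᶜ,
      (f x / ‖z‖ ^ ((finrank ℝ E : ℝ) + s + 1)) • z = 0 := by
    rw [← integral_indicator hmeas]
    refine integral_eq_zero_of_odd fun z => ?_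
    by_cases hz : z ∈ (Metric.ball (0 : E) ε)ᶜ
    · rw [Set.indicator_of_mem hz, Set.indicator_of_mem (by simpa using hz), norm_neg, smul_neg]
    · rw [Set.indicator_of_notMem hz, Set.indicator_of_notMem (by simpa using hz), neg_zero]
  have hsub : ∀ z, (f x / ‖z‖ ^ ((finrank ℝ E : ℝ) + s + 1)) • z =
      (f (x + z) / ‖z‖ ^ ((finrank ℝ E : ℝ) + s + 1)) • z -
        ((f (x + z) - f x) / ‖z‖ ^ ((finrank ℝ E : ℝ) + s + 1)) • z := fun z => by
    rw [← sub_smul]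
    congr 1
    ring
  simp_rw [hsub] at hodd
  rw [integral_sub hi hint.integrableOn, sub_eq_zero] at hodd
  exact hodd.symm

/-- The fractional gradient of order `s` is the superposition of the gradients of the heat flow with
respect to the weight of exponent `(1 - s) / 2`. -/
theorem testFracGrad_eq_integral_heatGrad {n : ℕ} [NeZero n] {f : EuclideanSpace ℝ (Fin n) → ℝ}
    (hf : IsCompactLipschitz f) {s : ℝ} (hs : 0 < s) (hs1 : s < 1) (x : EuclideanSpace ℝ (Fin n)) :
    testFracGrad s f x = ∫ t, heatGrad t f x ∂rieszMeasure ((1 - s) / 2) := by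
  have h := tendsto_integral_compl_ball hf hs hs1 x
  rw [← (integrable_sub_div_smul_and_integral hf hs hs1 x).2, ← h.limUnder_eq, testFracGrad,
    if_neg hs1.ne]
  simp only [finrank_euclideanSpace_fin]

end Subordination

/-! ### Superpositions of gradients of the heat flow -/

section RieszGrad

open Module

/-- The superposition `∫ ∇P_t f(x) t ^ (α - 1) / Γ(α) dt` of the gradients of the heat flow of `f`.
For `α = (1 - s) / 2` this is the fractional gradient of order `s`. -/
noncomputable def rieszGrad {E : Type*} [NormedAddCommGroup E] [InnerProductSpace ℝ E]
    [MeasurableSpace E] [BorelSpace E] [FiniteDimensional ℝ E] (α : ℝ) (f : E → ℝ) (x : E) : E :=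
  ∫ t, heatGrad t f x ∂rieszMeasure α

/-- Splitting of a superposition at time `T`, in a form which only involves `F` itself at times
larger than `T`. -/
theorem enorm_integral_rieszMeasure_le {V : Type*} [NormedAddCommGroup V] [NormedSpace ℝ V]
    {a b : ℝ} (ha : 0 < a) (hb : 0 < b) {F : ℝ → V} (hFm : StronglyMeasurable F)
    (hF : Integrable F (rieszMeasure (a + b))) (T : ℝ) :
    ‖∫ τ, F τ ∂rieszMeasure (a + b)‖ₑ ≤
      ∫⁻ t in Set.Iic T, ‖∫ r, F (t + r) ∂rieszMeasure b‖ₑ ∂rieszMeasure a +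
        ∫⁻ τ in Set.Ioi T, ‖F τ‖ₑ ∂rieszMeasure (a + b) := by
  have hadd : Measurable fun q : ℝ × ℝ => q.1 + q.2 := by fun_prop
  rw [← map_add_prod_rieszMeasure ha hb] at hF ⊢
  have hF' := (integrable_map_measure hFm.aestronglyMeasurable hadd.aemeasurable).1 hF
  have hind : Measurable ((Set.Ioi T).indicator fun τ => ‖F τ‖ₑ) :=
    hFm.enorm.indicator measurableSet_Ioi
  have hind' : Measurable fun q : ℝ × ℝ => (Set.Ioi T).indicator (fun τ => ‖F τ‖ₑ) (q.1 + q.2) :=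
    hind.comp hadd
  rw [integral_map hadd.aemeasurable hFm.aestronglyMeasurable,
    integral_prod (fun q : ℝ × ℝ => F (q.1 + q.2)) hF',
    ← lintegral_indicator measurableSet_Ioi, lintegral_map hind hadd,
    lintegral_prod _ hind'.aemeasurable]
  refine (enorm_integral_le_lintegral_enorm _).trans ?_
  rw [← lintegral_add_compl _ (measurableSet_Iic (a := T)), Set.compl_Iic]
  refine add_le_add_right ?_ _
  rw [← lintegral_indicator measurableSet_Ioi]
  refine lintegral_mono fun t => ?_
  by_cases ht : t ∈ Set.Ioi T
  · rw [Set.indicator_of_mem ht]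
    refine (enorm_integral_le_lintegral_enorm _).trans (lintegral_mono_ae ?_)
    filter_upwards [ae_rieszMeasure_pos b] with r hr
    rw [Set.indicator_of_mem]
    have : T < t := ht
    simp only [Set.mem_Ioi]
    linarith
  · rw [Set.indicator_of_notMem ht]
    exact zero_le

variable {E : Type*} [NormedAddCommGroup E] [InnerProductSpace ℝ E]
    [MeasurableSpace E] [BorelSpace E] [FiniteDimensional ℝ E] {f g : E → ℝ}

/-- Minkowski's inequality for superpositions of kernel operators. -/
theorem eLpNorm_lintegral_lintegral_le {V W : Type*} [NormedAddCommGroup V] [MeasurableSpace V]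
    [BorelSpace V] [NormedAddCommGroup W] {ρ : Measure ℝ} [SFinite ρ] {k : ℝ → E → V}
    (hk : Measurable fun q : ℝ × E => k q.1 q.2) {A : ℝ≥0∞} (hA : A ≠ ∞)
    (hkA : ∫⁻ t, (∫⁻ z, ‖k t z‖ₑ) ∂ρ ≤ A) {h : E → W} (hh : StronglyMeasurable h) {p : ℝ≥0∞}
    (hp : 1 ≤ p) (hp' : p ≠ ∞) :
    eLpNorm (fun x => ∫⁻ t, (∫⁻ z, ‖k t z‖ₑ * ‖h (x + z)‖ₑ) ∂ρ) p volume ≤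
      A * eLpNorm h p volume := by
  have hk' : Measurable fun q : ℝ × E => ‖k q.1 q.2‖ₑ := hk.enorm
  set μ : Measure (ℝ × E) := (ρ.prod volume).withDensity fun q => ‖k q.1 q.2‖ₑ with hμ
  have huniv : μ Set.univ ≤ A := by
    rw [hμ, withDensity_apply _ MeasurableSet.univ, Measure.restrict_univ,
      lintegral_prod _ hk'.aemeasurable]
    exact hkA
  have : IsFiniteMeasure μ := ⟨huniv.trans_lt hA.lt_top⟩
  refine (eLpNorm_le_of_enorm_le_lintegral_translate μ measurable_snd hh hp hp'
    fun x => ?_).trans (mul_le_mul_left huniv _)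
  have hhx : Measurable fun q : ℝ × E => ‖h (x + q.2)‖ₑ :=
    hh.enorm.comp (measurable_snd.const_add x)
  rw [enorm_eq_self, hμ, lintegral_withDensity_eq_lintegral_mul _ hk' hhx,
    lintegral_prod _ (hk'.mul hhx).aemeasurable]
  rfl

theorem measurable_lintegral_lintegral {V W : Type*} [NormedAddCommGroup V] [MeasurableSpace V]
    [BorelSpace V] [NormedAddCommGroup W] {ρ : Measure ℝ} [SFinite ρ] {k : ℝ → E → V}
    (hk : Measurable fun q : ℝ × E => k q.1 q.2) {h : E → W} (hh : StronglyMeasurable h) :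
    Measurable fun x => ∫⁻ t, (∫⁻ z, ‖k t z‖ₑ * ‖h (x + z)‖ₑ) ∂ρ := by
  have h1 : Measurable fun q : (E × ℝ) × E => ‖k q.1.2 q.2‖ₑ :=
    hk.enorm.comp ((measurable_snd.comp measurable_fst).prodMk measurable_snd)
  have h2 : Measurable fun q : (E × ℝ) × E => ‖h (q.1.1 + q.2)‖ₑ :=
    hh.enorm.comp ((measurable_fst.comp measurable_fst).add measurable_snd)
  exact (h1.mul h2).lintegral_prod_right'.lintegral_prod_right'

theorem stronglyMeasurable_rieszGrad (hf : Continuous f) (α : ℝ) :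
    StronglyMeasurable (rieszGrad α f) :=
  (stronglyMeasurable_heatGrad hf).integral_prod_left

theorem rieszGrad_sub [Nontrivial E] (hf : IsCompactLipschitz f) (hg : IsCompactLipschitz g)
    {α : ℝ} (hα : 0 < α) (hα' : α < 1 / 2) (x : E) :
    rieszGrad α (fun x => f x - g x) x = rieszGrad α f x - rieszGrad α g x := by
  unfold rieszGrad
  rw [← integral_sub (integrable_heatGrad_rieszMeasure hf hα hα' x)
    (integrable_heatGrad_rieszMeasure hg hα hα' x)]
  refine integral_congr_ae ?_
  filter_upwards [ae_rieszMeasure_pos α] with t ht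
  have hk := integrable_heatGradKernel (E := E) ht
  simp only [heatGrad, sub_smul]
  exact integral_sub (hf.integrable_smul hk x) (hg.integrable_smul hk x)

theorem exists_norm_rieszGrad_le [Nontrivial E] (hf : IsCompactLipschitz f)
    {α : ℝ} (hα : 0 < α) (hα' : α < 1 / 2) : ∃ C : ℝ, ∀ x, ‖rieszGrad α f x‖ ≤ C := by
  obtain ⟨C, hC0, hC⟩ := exists_norm_heatGrad_le hf
  refine ⟨_, fun x => norm_integral_le_of_norm_le
    ((integrable_min_one_rpow_rieszMeasure hα hα').const_mul C) ?_⟩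
  filter_upwards [ae_rieszMeasure_pos α] with t ht using hC t ht x

theorem lintegral_enorm_heatKernel {t : ℝ} (ht : 0 < t) : ∫⁻ z : E, ‖heatKernel t z‖ₑ = 1 := by
  have h := ofReal_integral_eq_lintegral_ofReal (integrable_heatKernel (E := E) ht)
    (ae_of_all _ fun z => (heatKernel_pos ht z).le)
  rw [integral_heatKernel ht, ENNReal.ofReal_one] at h
  rw [h]
  exact lintegral_congr fun z => Real.enorm_of_nonneg (heatKernel_pos ht z).le

theorem lintegral_enorm_heatGradKernel_le [Nontrivial E] {t : ℝ} (ht : 0 < t) :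
    ∫⁻ z : E, ‖heatGradKernel t z‖ₑ ≤
      ENNReal.ofReal (heatGradConst E) * ENNReal.ofReal (t ^ (-(1 / 2) : ℝ)) := by
  rw [← ofReal_integral_norm_eq_lintegral_enorm (integrable_heatGradKernel ht),
    ← ENNReal.ofReal_mul (heatGradConst_pos E).le]
  exact ENNReal.ofReal_le_ofReal (integral_norm_heatGradKernel_le ht)

theorem lintegral_lintegral_heatKernel_Iic {a T : ℝ} (ha : 0 < a) (hT : 0 < T) :
    ∫⁻ t, (∫⁻ z : E, ‖heatKernel t z‖ₑ) ∂(rieszMeasure a).restrict (Set.Iic T) =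
      ENNReal.ofReal (T ^ a / Real.Gamma (a + 1)) := by
  rw [← rieszMeasure_Iic ha hT, ← setLIntegral_one]
  refine lintegral_congr_ae (ae_restrict_of_ae ?_)
  filter_upwards [ae_rieszMeasure_pos a] with t ht using lintegral_enorm_heatKernel ht

theorem lintegral_lintegral_heatGradKernel_le [Nontrivial E] (α : ℝ) (S : Set ℝ) :
    ∫⁻ t, (∫⁻ z : E, ‖heatGradKernel t z‖ₑ) ∂(rieszMeasure α).restrict S ≤
      ENNReal.ofReal (heatGradConst E) *
        ∫⁻ t in S, ENNReal.ofReal (t ^ (-(1 / 2) : ℝ)) ∂rieszMeasure α := by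
  rw [← lintegral_const_mul _ (by fun_prop)]
  refine lintegral_mono_ae (ae_restrict_of_ae ?_)
  filter_upwards [ae_rieszMeasure_pos α] with t ht using lintegral_enorm_heatGradKernel_le ht

theorem lintegral_lintegral_heatGradKernel_Ioi_le [Nontrivial E] {α T : ℝ} (hα : 0 < α)
    (hα' : α < 1 / 2) (hT : 0 < T) :
    ∫⁻ t, (∫⁻ z : E, ‖heatGradKernel t z‖ₑ) ∂(rieszMeasure α).restrict (Set.Ioi T) ≤
      ENNReal.ofReal (heatGradConst E / ((1 / 2 - α) * Real.Gamma α) * T ^ (α - 1 / 2)) := by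
  refine (lintegral_lintegral_heatGradKernel_le α _).trans_eq ?_
  rw [lintegral_Ioi_rpow_rieszMeasure hα (by linarith) hT,
    ← ENNReal.ofReal_mul (heatGradConst_pos E).le]
  congr 1
  rw [← sub_eq_add_neg, neg_sub]
  ring

theorem lintegral_lintegral_heatGradKernel_Iic_le [Nontrivial E] {α T : ℝ} (hα : 1 / 2 < α)
    (hT : 0 < T) :
    ∫⁻ t, (∫⁻ z : E, ‖heatGradKernel t z‖ₑ) ∂(rieszMeasure α).restrict (Set.Iic T) ≤
      ENNReal.ofReal (heatGradConst E / ((α - 1 / 2) * Real.Gamma α) * T ^ (α - 1 / 2)) := by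
  refine (lintegral_lintegral_heatGradKernel_le α _).trans_eq ?_
  rw [lintegral_Iic_rpow_rieszMeasure (by linarith) (by linarith) hT,
    ← ENNReal.ofReal_mul (heatGradConst_pos E).le]
  congr 1
  rw [← sub_eq_add_neg]
  ring

/-- A kernel operator may be applied under the superposition. -/
theorem integral_bilin_rieszGrad [Nontrivial E] {V₁ V₂ : Type*} [NormedAddCommGroup V₁]
    [NormedSpace ℝ V₁] [NormedAddCommGroup V₂] [NormedSpace ℝ V₂] [CompleteSpace V₂]
    (B : V₁ →L[ℝ] E →L[ℝ] V₂) {k : E → V₁} (hk : Integrable k) (hf : IsCompactLipschitz f)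
    {α : ℝ} (hα : 0 < α) (hα' : α < 1 / 2) (x : E) :
    ∫ y, B (k y) (rieszGrad α f (x + y)) =
      ∫ r, (∫ y, B (k y) (heatGrad r f (x + y))) ∂rieszMeasure α := by
  obtain ⟨C, hC0, hC⟩ := exists_norm_heatGrad_le hf
  have hm : StronglyMeasurable fun q : E × ℝ => heatGrad q.2 f (x + q.1) :=
    (stronglyMeasurable_heatGrad hf.continuous).comp_measurable
      (measurable_snd.prodMk (measurable_fst.const_add x))
  have hint : Integrable (fun q : E × ℝ => B (k q.1) (heatGrad q.2 f (x + q.1)))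
      (volume.prod (rieszMeasure α)) := by
    refine Integrable.mono' ((hk.norm.const_mul ‖B‖).mul_prod
      ((integrable_min_one_rpow_rieszMeasure hα hα').const_mul C)) ?_ ?_
    · exact B.aestronglyMeasurable_comp₂ hk.aestronglyMeasurable.comp_fst hm.aestronglyMeasurable
    · have hpos : ∀ᵐ q : E × ℝ ∂volume.prod (rieszMeasure α), 0 < q.2 :=
        Measure.quasiMeasurePreserving_snd.ae (ae_rieszMeasure_pos α)
      filter_upwards [hpos] with q hq
      exact (B.le_opNorm₂ _ _).trans
        (mul_le_mul_of_nonneg_left (hC _ hq _) (by positivity))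
  rw [← integral_integral_swap hint]
  refine integral_congr_ae (ae_of_all _ fun y => ?_)
  exact (ContinuousLinearMap.integral_comp_comm _
    (integrable_heatGrad_rieszMeasure hf hα hα' (x + y))).symm

end RieszGrad

/-! ### Estimates in `L^p` -/

section Estimates

open Module

variable {E : Type*} [NormedAddCommGroup E] [InnerProductSpace ℝ E]
    [MeasurableSpace E] [BorelSpace E] [FiniteDimensional ℝ E] {f : E → ℝ}

theorem enorm_heatGrad_le (t : ℝ) (f : E → ℝ) (x : E) :
    ‖heatGrad t f x‖ₑ ≤ ∫⁻ z, ‖heatGradKernel t z‖ₑ * ‖f (x + z)‖ₑ := by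
  refine (enorm_integral_le_lintegral_enorm _).trans_eq ?_
  simp_rw [enorm_smul, mul_comm]

/-- Short times are controlled by the gradient of lower order, long times by the function. -/
theorem eLpNorm_rieszGrad_add_le [Nontrivial E] (hf : IsCompactLipschitz f) {a b T : ℝ}
    (ha : 0 < a) (hb : 0 < b) (hab : a + b < 1 / 2) (hT : 0 < T) {p : ℝ≥0∞} (hp : 1 ≤ p)
    (hp' : p ≠ ∞) :
    eLpNorm (rieszGrad (a + b) f) p volume ≤
      ENNReal.ofReal (T ^ a / Real.Gamma (a + 1)) * eLpNorm (rieszGrad b f) p volume +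
        ENNReal.ofReal (heatGradConst E / ((1 / 2 - (a + b)) * Real.Gamma (a + b)) *
          T ^ (a + b - 1 / 2)) * eLpNorm f p volume := by
  have hb' : b < 1 / 2 := by linarith
  have hfs : StronglyMeasurable f := hf.continuous.stronglyMeasurable
  have hgs : StronglyMeasurable (rieszGrad b f) := stronglyMeasurable_rieszGrad hf.continuous b
  have hF : ∀ x, ‖rieszGrad (a + b) f x‖ₑ ≤
      ∫⁻ t, (∫⁻ y, ‖heatKernel t y‖ₑ * ‖rieszGrad b f (x + y)‖ₑ)
        ∂(rieszMeasure a).restrict (Set.Iic T) +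
      ∫⁻ t, (∫⁻ z, ‖heatGradKernel t z‖ₑ * ‖f (x + z)‖ₑ)
        ∂(rieszMeasure (a + b)).restrict (Set.Ioi T) := by
    intro x
    have hm : StronglyMeasurable fun t => heatGrad t f x :=
      (stronglyMeasurable_heatGrad hf.continuous).comp_measurable
        (measurable_id.prodMk measurable_const)
    refine (enorm_integral_rieszMeasure_le ha hb hm
      (integrable_heatGrad_rieszMeasure hf (add_pos ha hb) hab x) T).trans (add_le_add ?_ ?_)
    · refine lintegral_mono_ae (ae_restrict_of_ae ?_)
      filter_upwards [ae_rieszMeasure_pos a] with t ht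
      have h := integral_bilin_rieszGrad (ContinuousLinearMap.lsmul ℝ ℝ)
        (integrable_heatKernel ht) hf hb hb' x
      simp only [ContinuousLinearMap.lsmul_apply] at h
      have h2 : ∫ r, heatGrad (t + r) f x ∂rieszMeasure b =
          ∫ y, heatKernel t y • rieszGrad b f (x + y) := by
        rw [h]
        refine integral_congr_ae ?_
        filter_upwards [ae_rieszMeasure_pos b] with r hr
          using (integral_heatKernel_smul_heatGrad hf ht hr x).symm
      rw [h2]
      refine (enorm_integral_le_lintegral_enorm _).trans_eq ?_
      simp_rw [enorm_smul]
    · exact lintegral_mono fun t => enorm_heatGrad_le t f x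
  refine (eLpNorm_mono_enorm fun x => (hF x).trans_eq (enorm_eq_self _).symm).trans ?_
  refine (eLpNorm_add_le
    (measurable_lintegral_lintegral measurable_heatKernel hgs).aestronglyMeasurable
    (measurable_lintegral_lintegral measurable_heatGradKernel hfs).aestronglyMeasurable hp).trans
    (add_le_add ?_ ?_)
  · exact eLpNorm_lintegral_lintegral_le measurable_heatKernel ENNReal.ofReal_ne_top
      (lintegral_lintegral_heatKernel_Iic ha hT).le hgs hp hp'
  · exact eLpNorm_lintegral_lintegral_le measurable_heatGradKernel ENNReal.ofReal_ne_top
      (lintegral_lintegral_heatGradKernel_Ioi_le (add_pos ha hb) hab hT) hfs hp hp'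

theorem lintegral_Ioi_enorm_heatLaplace_le [Nontrivial E] (hf : IsCompactLipschitz f) {T : ℝ}
    (hT : 0 < T) (x : E) :
    ∫⁻ t in Set.Ioi T, ‖heatLaplace t f x‖ₑ ≤
      ENNReal.ofReal (heatLaplaceConst E * (2 / finrank ℝ E) *
        T ^ (-((finrank ℝ E : ℝ) / 2))) * ∫⁻ z, ‖f (x + z)‖ₑ := by
  have hd : (0 : ℝ) < finrank ℝ E := by exact_mod_cast finrank_pos
  have hc : 0 ≤ heatLaplaceConst E := by unfold heatLaplaceConst; positivity
  have hfi : Integrable fun z => f (x + z) := hf.integrable.comp_add_left x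
  have hi := (integrableOn_Ioi_rpow_of_lt
    (show -((finrank ℝ E : ℝ) / 2) - 1 < -1 by linarith) hT).const_mul (heatLaplaceConst E)
  have hi' := Integrable.mul_const hi (∫ z, |f (x + z)|)
  have hpos : 0 ≤ ∫ z, |f (x + z)| := integral_nonneg fun z => abs_nonneg _
  calc ∫⁻ t in Set.Ioi T, ‖heatLaplace t f x‖ₑ
      ≤ ∫⁻ t in Set.Ioi T, ENNReal.ofReal
          (heatLaplaceConst E * t ^ (-((finrank ℝ E : ℝ) / 2) - 1) * ∫ z, |f (x + z)|) := by
        refine setLIntegral_mono' measurableSet_Ioi fun t ht => ?_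
        rw [← ofReal_norm]
        exact ENNReal.ofReal_le_ofReal (abs_heatLaplace_le hf (hT.trans ht) x)
    _ = ENNReal.ofReal (∫ t in Set.Ioi T,
          heatLaplaceConst E * t ^ (-((finrank ℝ E : ℝ) / 2) - 1) * ∫ z, |f (x + z)|) := by
        refine (ofReal_integral_eq_lintegral_ofReal hi' ?_).symm
        filter_upwards [ae_restrict_mem measurableSet_Ioi] with t ht
        have : 0 < t := hT.trans ht
        positivity
    _ = _ := by
        have e : ∫⁻ z, ‖f (x + z)‖ₑ = ENNReal.ofReal (∫ z, |f (x + z)|) :=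
          (ofReal_integral_norm_eq_lintegral_enorm hfi).symm
        rw [e, ← ENNReal.ofReal_mul (by positivity), integral_mul_const, integral_const_mul,
          integral_Ioi_rpow_of_lt (by linarith) hT, sub_add_cancel]
        congr 1
        field_simp

/-- The local Poincaré inequality before absorption: the function is recovered from its fractional
gradient by integrating the Laplacian of its heat flow over all times. -/
theorem eLpNorm_le_eLpNorm_rieszGrad_add [Nontrivial E] (hf : IsCompactLipschitz f) {R : ℝ}
    (hfR : ∀ x, R < ‖x‖ → f x = 0) {α T : ℝ} (hα : 0 < α) (hα' : α < 1 / 2) (hT : 0 < T)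
    {p : ℝ≥0∞} (hp : 1 ≤ p) (hp' : p ≠ ∞) :
    eLpNorm f p volume ≤
      ENNReal.ofReal (heatGradConst E / ((1 - α - 1 / 2) * Real.Gamma (1 - α)) *
        T ^ (1 - α - 1 / 2)) * eLpNorm (rieszGrad α f) p volume +
      ENNReal.ofReal (heatLaplaceConst E * (2 / finrank ℝ E) * T ^ (-((finrank ℝ E : ℝ) / 2))) *
        volume (Metric.closedBall (0 : E) (2 * R)) * eLpNorm f p volume := by
  have hfs : StronglyMeasurable f := hf.continuous.stronglyMeasurable
  have hgs : StronglyMeasurable (rieszGrad α f) := stronglyMeasurable_rieszGrad hf.continuous α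
  set c : ℝ≥0∞ := ENNReal.ofReal
    (heatLaplaceConst E * (2 / finrank ℝ E) * T ^ (-((finrank ℝ E : ℝ) / 2))) with hc
  set μ : Measure E := c • volume.restrict (Metric.closedBall (0 : E) (2 * R)) with hμ
  have hμuniv : μ Set.univ = c * volume (Metric.closedBall (0 : E) (2 * R)) := by simp [hμ]
  have : IsFiniteMeasure μ := ⟨by
    rw [hμuniv]
    exact ENNReal.mul_lt_top ENNReal.ofReal_lt_top measure_closedBall_lt_top⟩
  have hF : ∀ x, ‖f x‖ₑ ≤
      ∫⁻ t, (∫⁻ y, ‖heatGradKernel t y‖ₑ * ‖rieszGrad α f (x + y)‖ₑ)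
        ∂(rieszMeasure (1 - α)).restrict (Set.Iic T) + ∫⁻ z, ‖f (x + z)‖ₑ ∂μ := by
    intro x
    by_cases hx : R < ‖x‖
    · simp [hfR x hx]
    have hm : StronglyMeasurable fun t => heatLaplace t f x :=
      (stronglyMeasurable_heatLaplace hf.continuous).comp_measurable
        (measurable_id.prodMk measurable_const)
    have h1 : rieszMeasure (1 - α + α) = volume.restrict (Set.Ioi 0) := by
      rw [sub_add_cancel, rieszMeasure_one]
    have hint : Integrable (fun t => heatLaplace t f x) (rieszMeasure (1 - α + α)) := by
      rw [h1]
      exact integrableOn_heatLaplace hf x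
    have h2 := enorm_integral_rieszMeasure_le (by linarith : 0 < 1 - α) hα hm hint T
    rw [h1, integral_heatLaplace hf, enorm_neg, Measure.restrict_restrict measurableSet_Ioi,
      Set.inter_eq_left.2 (Set.Ioi_subset_Ioi hT.le)] at h2
    refine h2.trans (add_le_add ?_ ?_)
    · refine lintegral_mono_ae (ae_restrict_of_ae ?_)
      filter_upwards [ae_rieszMeasure_pos (1 - α)] with t ht
      have h : ∫ y, inner ℝ (heatGradKernel t y) (rieszGrad α f (x + y)) =
          ∫ r, (∫ y, inner ℝ (heatGradKernel t y) (heatGrad r f (x + y))) ∂rieszMeasure α :=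
        integral_bilin_rieszGrad (innerSL ℝ) (integrable_heatGradKernel ht) hf hα hα' x
      have h3 : ∫ r, heatLaplace (t + r) f x ∂rieszMeasure α =
          ∫ y, inner ℝ (heatGradKernel t y) (rieszGrad α f (x + y)) := by
        rw [h]
        refine integral_congr_ae ?_
        filter_upwards [ae_rieszMeasure_pos α] with r hr
          using (integral_inner_heatGrad hf ht hr x).symm
      rw [h3]
      refine (enorm_integral_le_lintegral_enorm _).trans (lintegral_mono fun y => ?_)
      simp_rw [← ofReal_norm]
      rw [← ENNReal.ofReal_mul (norm_nonneg _)]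
      exact ENNReal.ofReal_le_ofReal (norm_inner_le_norm _ _)
    · refine (lintegral_Ioi_enorm_heatLaplace_le hf hT x).trans_eq ?_
      rw [hμ, lintegral_smul_measure, smul_eq_mul,
        ← lintegral_indicator Metric.isClosed_closedBall.measurableSet]
      congr 2
      ext z
      by_cases hz : z ∈ Metric.closedBall (0 : E) (2 * R)
      · rw [Set.indicator_of_mem hz]
      · rw [Set.indicator_of_notMem hz, hfR, enorm_zero]
        have hz' : 2 * R < ‖z‖ := by simpa using hz
        have := norm_sub_le (x + z) x
        rw [add_sub_cancel_left] at this
        linarith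
  have hm2 : Measurable fun x => ∫⁻ z, ‖f (x + z)‖ₑ ∂μ :=
    Measurable.lintegral_prod_right' (f := fun q : E × E => ‖f (q.1 + q.2)‖ₑ)
      (hfs.enorm.comp (measurable_fst.add measurable_snd))
  refine (eLpNorm_mono_enorm fun x => (hF x).trans_eq (enorm_eq_self _).symm).trans ?_
  refine (eLpNorm_add_le
    (measurable_lintegral_lintegral measurable_heatGradKernel hgs).aestronglyMeasurable
    hm2.aestronglyMeasurable hp).trans (add_le_add ?_ ?_)
  · exact eLpNorm_lintegral_lintegral_le measurable_heatGradKernel ENNReal.ofReal_ne_top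
      (lintegral_lintegral_heatGradKernel_Iic_le (by linarith) hT) hgs hp hp'
  · rw [← hμuniv]
    exact eLpNorm_le_of_enorm_le_lintegral_translate μ measurable_id hfs hp hp'
      fun x => (enorm_eq_self _).le

/-- The fractional gradient of a compactly supported Lipschitz function belongs to `L^p`: at short
times the increments of `f` compensate the singularity of the kernel, and they vanish unless one of
their end points lies in the support of `f`. -/
theorem eLpNorm_rieszGrad_lt_top [Nontrivial E] (hf : IsCompactLipschitz f) {α : ℝ}
    (hα : 0 < α) (hα' : α < 1 / 2) {p : ℝ≥0∞} (hp : 1 ≤ p) (hp' : p ≠ ∞) :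
    eLpNorm (rieszGrad α f) p volume < ∞ := by
  obtain ⟨M, hM0, hM, hL⟩ := hf.exists_bound
  have hfs : StronglyMeasurable f := hf.continuous.stronglyMeasurable
  have hK : MeasurableSet (tsupport f) := (isClosed_tsupport f).measurableSet
  set h : E → ℝ := (tsupport f).indicator fun _ => M with hh
  have hhs : StronglyMeasurable h := stronglyMeasurable_const.indicator hK
  have hhp : eLpNorm h p volume < ∞ :=
    (memLp_indicator_const p hK M (Or.inr hf.hasCompactSupport.measure_lt_top.ne)).2
  have hh0 : ∀ x, 0 ≤ h x := fun x => Set.indicator_nonneg (fun _ _ => hM0) x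
  have hsub : ∀ x z, |f (x + z) - f x| ≤ (h x + h (x + z)) * ‖z‖ := by
    intro x z
    by_cases hx : x ∈ tsupport f
    · refine (hL x z).trans (mul_le_mul_of_nonneg_right ?_ (norm_nonneg _))
      have : h x = M := Set.indicator_of_mem hx _
      linarith [hh0 (x + z)]
    by_cases hxz : x + z ∈ tsupport f
    · refine (hL x z).trans (mul_le_mul_of_nonneg_right ?_ (norm_nonneg _))
      have : h (x + z) = M := Set.indicator_of_mem hxz _
      linarith [hh0 x]
    · rw [image_eq_zero_of_notMem_tsupport hx, image_eq_zero_of_notMem_tsupport hxz, sub_zero,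
        abs_zero]
      have := hh0 x
      have := hh0 (x + z)
      positivity
  set k : ℝ → E → E := fun t z => ‖z‖ • heatGradKernel t z with hk
  have hkm : Measurable fun q : ℝ × E => k q.1 q.2 :=
    measurable_snd.norm.smul measurable_heatGradKernel
  have hk1 : ∀ t, 0 < t → ∫⁻ z : E, ‖k t z‖ₑ = ENNReal.ofReal (finrank ℝ E) := by
    intro t ht
    rw [← integral_norm_heatGradKernel_mul_norm ht,
      ofReal_integral_eq_lintegral_ofReal (integrable_norm_heatGradKernel_mul_norm ht)
      (ae_of_all _ fun z => by positivity)]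
    refine lintegral_congr fun z => ?_
    rw [← ofReal_norm, hk]
    simp only [norm_smul, norm_norm, mul_comm]
  have hkA : ∫⁻ t, (∫⁻ z : E, ‖k t z‖ₑ) ∂(rieszMeasure α).restrict (Set.Iic 1) =
      ENNReal.ofReal (finrank ℝ E) * ENNReal.ofReal (1 ^ α / Real.Gamma (α + 1)) := by
    rw [← rieszMeasure_Iic hα one_pos, ← setLIntegral_const]
    refine lintegral_congr_ae (ae_restrict_of_ae ?_)
    filter_upwards [ae_rieszMeasure_pos α] with t ht using hk1 t ht
  set A : ℝ≥0∞ := ENNReal.ofReal (finrank ℝ E) * ENNReal.ofReal (1 ^ α / Real.Gamma (α + 1)) with hA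
  have hAtop : A ≠ ∞ := ENNReal.mul_ne_top ENNReal.ofReal_ne_top ENNReal.ofReal_ne_top
  have hF : ∀ x, ‖rieszGrad α f x‖ₑ ≤
      (A * ‖h x‖ₑ + ∫⁻ t, (∫⁻ z, ‖k t z‖ₑ * ‖h (x + z)‖ₑ) ∂(rieszMeasure α).restrict (Set.Iic 1)) +
      ∫⁻ t, (∫⁻ z, ‖heatGradKernel t z‖ₑ * ‖f (x + z)‖ₑ)
        ∂(rieszMeasure α).restrict (Set.Ioi 1) := by
    intro x
    refine (enorm_integral_le_lintegral_enorm _).trans ?_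
    rw [← lintegral_add_compl _ (measurableSet_Iic (a := (1 : ℝ))), Set.compl_Iic]
    refine add_le_add ?_ (lintegral_mono fun t => enorm_heatGrad_le t f x)
    have hkm' : Measurable fun t => ∫⁻ z, ‖k t z‖ₑ := hkm.enorm.lintegral_prod_right'
    rw [← hkA, ← lintegral_mul_const _ hkm', ← lintegral_add_left (hkm'.mul_const _)]
    refine lintegral_mono_ae (ae_restrict_of_ae ?_)
    filter_upwards [ae_rieszMeasure_pos α] with t ht
    have hkt : Measurable fun z => ‖k t z‖ₑ := (hkm.comp measurable_prodMk_left).enorm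
    rw [heatGrad_eq_integral_sub hf ht, ← lintegral_mul_const _ hkt,
      ← lintegral_add_left (hkt.mul_const _)]
    refine (enorm_integral_le_lintegral_enorm _).trans (lintegral_mono fun z => ?_)
    simp only [← ofReal_norm]
    rw [← ENNReal.ofReal_mul (norm_nonneg _), ← ENNReal.ofReal_mul (norm_nonneg _),
      ← ENNReal.ofReal_add (by positivity) (by positivity)]
    refine ENNReal.ofReal_le_ofReal ?_
    rw [norm_smul, hk, norm_smul, norm_norm, Real.norm_of_nonneg (hh0 x),
      Real.norm_of_nonneg (hh0 (x + z)), Real.norm_eq_abs]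
    refine (mul_le_mul_of_nonneg_right (hsub x z) (norm_nonneg _)).trans_eq ?_
    ring
  have hm0 : Measurable fun x => A * ‖h x‖ₑ := hhs.enorm.const_mul A
  have hm1 := measurable_lintegral_lintegral (ρ := (rieszMeasure α).restrict (Set.Iic 1)) hkm hhs
  have hm2 := measurable_lintegral_lintegral (ρ := (rieszMeasure α).restrict (Set.Ioi 1))
    measurable_heatGradKernel hfs
  refine (eLpNorm_mono_enorm fun x => (hF x).trans_eq (enorm_eq_self _).symm).trans_lt ?_
  refine (eLpNorm_add_le (hm0.add hm1).aestronglyMeasurable hm2.aestronglyMeasurable hp).trans_lt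
    (ENNReal.add_lt_top.2 ⟨?_, ?_⟩)
  · refine (eLpNorm_add_le hm0.aestronglyMeasurable hm1.aestronglyMeasurable hp).trans_lt
      (ENNReal.add_lt_top.2 ⟨?_, ?_⟩)
    · refine (eLpNorm_le_mul_eLpNorm_of_ae_le_mul'' p hhs.aestronglyMeasurable
        (ae_of_all _ fun x => (enorm_eq_self _).le)).trans_lt ?_
      exact ENNReal.mul_lt_top hAtop.lt_top hhp
    · exact (eLpNorm_lintegral_lintegral_le hkm hAtop hkA.le hhs hp hp').trans_lt
        (ENNReal.mul_lt_top hAtop.lt_top hhp)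
  · exact (eLpNorm_lintegral_lintegral_le measurable_heatGradKernel ENNReal.ofReal_ne_top
      (lintegral_lintegral_heatGradKernel_Ioi_le hα hα' one_pos) hfs hp hp').trans_lt
      (ENNReal.mul_lt_top ENNReal.ofReal_lt_top
        (hf.continuous.memLp_of_hasCompactSupport hf.hasCompactSupport).2)

/-- Absorption of a term with a small constant. -/
theorem ENNReal.le_two_mul_of_le_add_mul {X Y ε : ℝ≥0∞} (hX : X ≠ ∞) (hε : ε ≤ 1 / 2)
    (h : X ≤ Y + ε * X) : X ≤ 2 * Y := by
  have h1 : X ≤ Y + X / 2 := by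
    refine h.trans (add_le_add_right ?_ _)
    rw [div_eq_mul_inv, mul_comm X, ← one_div]
    exact mul_le_mul_left hε _
  have h2 : X / 2 ≤ Y := by
    have h3 : X / 2 + X / 2 ≤ Y + X / 2 := by rwa [ENNReal.add_halves]
    exact (ENNReal.add_le_add_iff_right (ENNReal.div_lt_top hX two_ne_zero).ne).1 h3
  calc X = 2 * (X / 2) := (ENNReal.mul_div_cancel two_ne_zero ENNReal.ofNat_ne_top).symm
    _ ≤ 2 * Y := mul_le_mul_right h2 _

theorem exists_const_mul_rpow_le {c q δ : ℝ} (hq : q < 0) (hδ : 0 < δ) :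
    ∃ T : ℝ, 1 ≤ T ∧ c * T ^ q ≤ δ := by
  have h : Tendsto (fun T : ℝ => c * T ^ q) atTop (𝓝 0) := by
    have := (tendsto_rpow_neg_atTop (neg_pos.2 hq)).const_mul c
    simpa using this
  obtain ⟨T, hT1, hT2⟩ := ((eventually_ge_atTop 1).and (h.eventually (ge_mem_nhds hδ))).exists
  exact ⟨T, hT1, hT2⟩

/-- The Poincaré inequality for functions supported in a fixed ball, uniformly in the exponent. -/
theorem exists_eLpNorm_le_mul_eLpNorm_rieszGrad [Nontrivial E] {α : ℝ} (hα : 0 < α)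
    (hα' : α < 1 / 2) (R : ℝ) : ∃ C : ℝ, 0 ≤ C ∧ ∀ f : E → ℝ, IsCompactLipschitz f →
      (∀ x, R < ‖x‖ → f x = 0) → ∀ p : ℝ≥0∞, 1 ≤ p → p ≠ ∞ →
        eLpNorm f p volume ≤ ENNReal.ofReal C * eLpNorm (rieszGrad α f) p volume := by
  have hd : (0 : ℝ) < finrank ℝ E := by exact_mod_cast finrank_pos
  have hc : 0 ≤ heatLaplaceConst E := by unfold heatLaplaceConst; positivity
  set v : ℝ := volume.real (Metric.closedBall (0 : E) (2 * R)) with hv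
  have hv' : volume (Metric.closedBall (0 : E) (2 * R)) = ENNReal.ofReal v :=
    (ENNReal.ofReal_toReal measure_closedBall_lt_top.ne).symm
  obtain ⟨T, hT1, hT⟩ := exists_const_mul_rpow_le (c := heatLaplaceConst E * (2 / finrank ℝ E) * v)
    (show -((finrank ℝ E : ℝ) / 2) < 0 by linarith) one_half_pos
  have hT0 : 0 < T := by linarith
  have hΓ : 0 < Real.Gamma (1 - α) := Real.Gamma_pos_of_pos (by linarith)
  have hg := heatGradConst_pos E
  have hα2 : 0 < 1 - α - 1 / 2 := by linarith
  refine ⟨2 * (heatGradConst E / ((1 - α - 1 / 2) * Real.Gamma (1 - α)) * T ^ (1 - α - 1 / 2)),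
    by positivity, fun f hf hfR p hp hp' => ?_⟩
  have h := eLpNorm_le_eLpNorm_rieszGrad_add hf hfR hα hα' hT0 hp hp'
  rw [hv', ← ENNReal.ofReal_mul (by positivity)] at h
  have hX : eLpNorm f p volume ≠ ∞ :=
    (hf.continuous.memLp_of_hasCompactSupport hf.hasCompactSupport).2.ne
  refine (ENNReal.le_two_mul_of_le_add_mul hX ?_ h).trans_eq ?_
  · rw [← ENNReal.ofReal_one, ← ENNReal.ofReal_ofNat, ← ENNReal.ofReal_div_of_pos two_pos]
    refine ENNReal.ofReal_le_ofReal (le_trans (le_of_eq ?_) hT)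
    ring
  · rw [← mul_assoc, ENNReal.ofReal_mul two_pos.le, ENNReal.ofReal_ofNat]

/-- Comparison of fractional gradients of different orders on functions supported in a fixed ball.
The constant depends neither on the splitting `a + b` nor on the exponent `p`. -/
theorem exists_eLpNorm_rieszGrad_add_le [Nontrivial E] {α : ℝ} (hα : 0 < α)
    (hα' : α < 1 / 2) (R : ℝ) : ∃ C : ℝ, 0 ≤ C ∧ ∀ a b : ℝ, 0 < a → 0 < b → a + b = α →
      ∀ f : E → ℝ, IsCompactLipschitz f → (∀ x, R < ‖x‖ → f x = 0) → ∀ p : ℝ≥0∞, 1 ≤ p → p ≠ ∞ →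
        eLpNorm (rieszGrad α f) p volume ≤
          ENNReal.ofReal C * eLpNorm (rieszGrad b f) p volume := by
  obtain ⟨P, hP0, hP⟩ := exists_eLpNorm_le_mul_eLpNorm_rieszGrad (E := E) hα hα' R
  have hΓ := Real.Gamma_pos_of_pos hα
  have hg := heatGradConst_pos E
  have hα2 : 0 < 1 / 2 - α := by linarith
  obtain ⟨T, hT1, hT⟩ := exists_const_mul_rpow_le
    (c := heatGradConst E / ((1 / 2 - α) * Real.Gamma α) * P)
    (show α - 1 / 2 < 0 by linarith) one_half_pos
  have hT0 : 0 < T := by linarith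
  -- `Γ` is bounded away from zero on `[1, 2]`.
  have hcont : ContinuousOn Real.Gamma (Set.Icc (1 : ℝ) 2) := fun x hx =>
    (Real.differentiableAt_Gamma fun m => by
      have : (0 : ℝ) ≤ m := m.cast_nonneg
      linarith [hx.1]).continuousAt.continuousWithinAt
  obtain ⟨y, hy, hmin⟩ := isCompact_Icc.exists_isMinOn (Set.nonempty_Icc.2 one_le_two) hcont
  have hΓy : 0 < Real.Gamma y := Real.Gamma_pos_of_pos (one_pos.trans_le hy.1)
  refine ⟨2 * (T / Real.Gamma y), by positivity, fun a b ha hb hab f hf hfR p hp hp' => ?_⟩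
  subst hab
  have h := eLpNorm_rieszGrad_add_le hf ha hb hα' hT0 hp hp'
  have h1 : T ^ a / Real.Gamma (a + 1) ≤ T / Real.Gamma y := by
    have hΓa : Real.Gamma y ≤ Real.Gamma (a + 1) := hmin ⟨by linarith, by linarith⟩
    have hTa : T ^ a ≤ T := by
      calc T ^ a ≤ T ^ (1 : ℝ) := Real.rpow_le_rpow_of_exponent_le hT1 (by linarith)
        _ = T := Real.rpow_one T
    gcongr
  have h2 : eLpNorm (rieszGrad (a + b) f) p volume ≤
      ENNReal.ofReal (T / Real.Gamma y) * eLpNorm (rieszGrad b f) p volume +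
        ENNReal.ofReal (heatGradConst E / ((1 / 2 - (a + b)) * Real.Gamma (a + b)) *
          T ^ (a + b - 1 / 2) * P) * eLpNorm (rieszGrad (a + b) f) p volume := by
    refine h.trans (add_le_add (mul_le_mul_left (ENNReal.ofReal_le_ofReal h1) _) ?_)
    rw [ENNReal.ofReal_mul (p := _ * T ^ (a + b - 1 / 2)) (by positivity), mul_assoc]
    exact mul_le_mul_right (hP f hf hfR p hp hp') _
  refine (ENNReal.le_two_mul_of_le_add_mul (eLpNorm_rieszGrad_lt_top hf hα hα' hp hp').ne ?_
    h2).trans_eq ?_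
  · rw [← ENNReal.ofReal_one, ← ENNReal.ofReal_ofNat, ← ENNReal.ofReal_div_of_pos two_pos]
    refine ENNReal.ofReal_le_ofReal (le_trans (le_of_eq ?_) hT)
    ring
  · rw [← mul_assoc, ENNReal.ofReal_mul two_pos.le, ENNReal.ofReal_ofNat]

end Estimates

/-! ### Integration by parts and uniqueness of the fractional gradient -/

section Duality

open Module

variable {E : Type*} [NormedAddCommGroup E] [InnerProductSpace ℝ E]
    [MeasurableSpace E] [BorelSpace E] [FiniteDimensional ℝ E] {f g : E → ℝ}

theorem integral_smul_heatGrad [Nontrivial E] (hf : IsCompactLipschitz f)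
    (hg : IsCompactLipschitz g) {t : ℝ} (ht : 0 < t) :
    ∫ x, g x • heatGrad t f x = -∫ x, f x • heatGrad t g x := by
  have hk := integrable_heatGradKernel (E := E) ht
  have hint : ∀ {f g : E → ℝ}, IsCompactLipschitz f → IsCompactLipschitz g →
      Integrable (fun q : E × E => g q.1 • f (q.1 + q.2) • heatGradKernel t q.2)
        (volume.prod volume) := by
    intro f g hf hg
    obtain ⟨M, hM0, hM, -⟩ := hf.exists_bound
    refine Integrable.mono' ((hg.integrable.norm.const_mul M).mul_prod hk.norm) ?_
      (ae_of_all _ fun q => ?_)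
    · exact ((hg.continuous.comp continuous_fst).smul ((hf.continuous.comp (by fun_prop)).smul
        ((continuous_heatGradKernel t).comp continuous_snd))).aestronglyMeasurable
    · rw [norm_smul, norm_smul, ← mul_assoc, mul_comm M]
      exact mul_le_mul_of_nonneg_right (mul_le_mul_of_nonneg_left (hM _) (norm_nonneg _))
        (norm_nonneg _)
  calc ∫ x, g x • heatGrad t f x
      = ∫ x, ∫ z, g x • f (x + z) • heatGradKernel t z := by
        simp_rw [heatGrad, integral_smul]
    _ = ∫ z, ∫ x, g x • f (x + z) • heatGradKernel t z := integral_integral_swap (hint hf hg)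
    _ = ∫ z, ∫ x, g (x + z) • f x • heatGradKernel t (-z) := by
        rw [← integral_neg_eq_self]
        refine integral_congr_ae (ae_of_all _ fun z => ?_)
        simp only
        rw [← integral_add_right_eq_self _ z]
        simp
    _ = -∫ z, ∫ x, f x • g (x + z) • heatGradKernel t z := by
        rw [← integral_neg]
        refine integral_congr_ae (ae_of_all _ fun z => ?_)
        simp only
        rw [← integral_neg]
        refine integral_congr_ae (ae_of_all _ fun x => ?_)
        simp only [heatGradKernel_neg, smul_neg]
        rw [smul_comm]
    _ = -∫ x, ∫ z, f x • g (x + z) • heatGradKernel t z := by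
        rw [← integral_integral_swap (hint hg hf)]
    _ = _ := by simp_rw [heatGrad, integral_smul]

/-- Integration by parts for the fractional gradient. -/
theorem integral_smul_rieszGrad [Nontrivial E] (hf : IsCompactLipschitz f)
    (hg : IsCompactLipschitz g) {α : ℝ} (hα : 0 < α) (hα' : α < 1 / 2) :
    ∫ x, g x • rieszGrad α f x = -∫ x, f x • rieszGrad α g x := by
  have hswap : ∀ {f g : E → ℝ}, IsCompactLipschitz f → IsCompactLipschitz g →
      ∫ x, g x • rieszGrad α f x = ∫ t, (∫ x, g x • heatGrad t f x) ∂rieszMeasure α := by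
    intro f g hf hg
    obtain ⟨C, hC0, hC⟩ := exists_norm_heatGrad_le hf
    have hint : Integrable (fun q : E × ℝ => g q.1 • heatGrad q.2 f q.1)
        (volume.prod (rieszMeasure α)) := by
      refine Integrable.mono' (hg.integrable.norm.mul_prod
        ((integrable_min_one_rpow_rieszMeasure hα hα').const_mul C)) ?_ ?_
      · exact ((hg.continuous.comp continuous_fst).stronglyMeasurable.smul
          ((stronglyMeasurable_heatGrad hf.continuous).comp_measurable
            measurable_swap)).aestronglyMeasurable
      · have hpos : ∀ᵐ q : E × ℝ ∂volume.prod (rieszMeasure α), 0 < q.2 :=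
          Measure.quasiMeasurePreserving_snd.ae (ae_rieszMeasure_pos α)
        filter_upwards [hpos] with q hq
        rw [norm_smul]
        exact mul_le_mul_of_nonneg_left (hC _ hq _) (norm_nonneg _)
    rw [← integral_integral_swap hint]
    simp_rw [rieszGrad, integral_smul]
  rw [hswap hf hg, hswap hg hf, ← integral_neg]
  refine integral_congr_ae ?_
  filter_upwards [ae_rieszMeasure_pos α] with t ht using integral_smul_heatGrad hf hg ht

theorem memLp_rieszGrad [Nontrivial E] (hf : IsCompactLipschitz f) {α : ℝ} (hα : 0 < α)
    (hα' : α < 1 / 2) {p : ℝ≥0∞} (hp : 1 ≤ p) : MemLp (rieszGrad α f) p := by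
  have hm := (stronglyMeasurable_rieszGrad hf.continuous α).aestronglyMeasurable
    (μ := (volume : Measure E))
  rcases eq_or_ne p ∞ with rfl | hp'
  · obtain ⟨C, hC⟩ := exists_norm_rieszGrad_le hf hα hα'
    exact memLp_top_of_bound hm C (ae_of_all _ hC)
  · exact ⟨hm, eLpNorm_rieszGrad_lt_top hf hα hα' hp hp'⟩

theorem enorm_integral_smul_le {V : Type*} [NormedAddCommGroup V] [NormedSpace ℝ V]
    {p q : ℝ≥0∞} [p.HolderConjugate q] {u : E → ℝ} {v : E → V} (hu : AEStronglyMeasurable u)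
    (hv : AEStronglyMeasurable v) :
    ‖∫ x, u x • v x‖ₑ ≤ eLpNorm u p volume * eLpNorm v q volume := by
  refine (enorm_integral_le_lintegral_enorm _).trans ?_
  rw [← eLpNorm_one_eq_lintegral_enorm]
  exact eLpNorm_smul_le_mul_eLpNorm hv hu

/-- The fractional gradient is closable in `L^p`. -/
theorem ae_eq_zero_of_tendsto_rieszGrad [Nontrivial E] {α : ℝ} (hα : 0 < α) (hα' : α < 1 / 2)
    {p : ℝ≥0∞} (hp : 1 ≤ p) {d : ℕ → E → ℝ} (hd : ∀ k, IsCompactLipschitz (d k)) {v : E → E}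
    (hv : MemLp v p) (h0 : Tendsto (fun k => eLpNorm (d k) p volume) atTop (𝓝 0))
    (h1 : Tendsto (fun k => eLpNorm (fun x => rieszGrad α (d k) x - v x) p volume) atTop (𝓝 0)) :
    v =ᵐ[volume] 0 := by
  refine ae_eq_zero_of_integral_contDiff_smul_eq_zero (hv.locallyIntegrable hp) fun η hη hηc => ?_
  have hη' : IsCompactLipschitz η := ⟨hηc, hη.lipschitzWith_of_hasCompactSupport hηc (by simp)⟩
  set q := ENNReal.conjExponent p with hq
  have hpq : p.HolderConjugate q := .conjExponent hp
  have hqp : q.HolderConjugate p := hpq.symm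
  have hq1 : 1 ≤ q := hpq.symm.one_le
  have hηq : MemLp η q := hη'.continuous.memLp_of_hasCompactSupport hηc
  have hGq : MemLp (rieszGrad α η) q := memLp_rieszGrad hη' hα hα' hq1
  have hbound : ∀ k, ‖∫ x, η x • v x‖ₑ ≤
      eLpNorm (d k) p volume * eLpNorm (rieszGrad α η) q volume +
        eLpNorm η q volume * eLpNorm (fun x => rieszGrad α (d k) x - v x) p volume := by
    intro k
    have hGk : MemLp (rieszGrad α (d k)) p := memLp_rieszGrad (hd k) hα hα' hp
    have i1 : Integrable fun x => η x • rieszGrad α (d k) x :=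
      memLp_one_iff_integrable.1 (hGk.smul (r := 1) hηq)
    have i2 : Integrable fun x => η x • (rieszGrad α (d k) x - v x) :=
      memLp_one_iff_integrable.1 ((hGk.sub hv).smul (r := 1) hηq)
    have e : ∫ x, η x • v x = -(∫ x, d k x • rieszGrad α η x) -
        ∫ x, η x • (rieszGrad α (d k) x - v x) := by
      rw [← integral_smul_rieszGrad (hd k) hη' hα hα', ← integral_sub i1 i2]
      refine integral_congr_ae (ae_of_all _ fun x => ?_)
      simp only
      rw [← smul_sub, sub_sub_cancel]
    rw [e]
    refine (enorm_sub_le).trans (add_le_add ?_ ?_)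
    · rw [enorm_neg]
      exact enorm_integral_smul_le (hd k).continuous.aestronglyMeasurable hGq.1
    · exact enorm_integral_smul_le hηq.1 (hGk.sub hv).1
  have hlim : Tendsto (fun k => eLpNorm (d k) p volume * eLpNorm (rieszGrad α η) q volume +
      eLpNorm η q volume * eLpNorm (fun x => rieszGrad α (d k) x - v x) p volume)
      atTop (𝓝 0) := by
    have := (ENNReal.Tendsto.mul_const h0 (Or.inr hGq.2.ne)).add
      (ENNReal.Tendsto.const_mul h1 (Or.inr hηq.2.ne))
    simpa using this
  have := ge_of_tendsto' hlim hbound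
  simpa using this

/-- Completeness of `L^p`, for sequences of functions. -/
theorem exists_memLp_tendsto_of_cauchy {V : Type*} [NormedAddCommGroup V] [CompleteSpace V]
    {p : ℝ≥0∞} (hp : 1 ≤ p) {F : ℕ → E → V} (hF : ∀ k, MemLp (F k) p)
    (hc : ∀ ε : ℝ≥0∞, 0 < ε → ∃ N, ∀ j k, N ≤ j → N ≤ k →
      eLpNorm (fun x => F j x - F k x) p volume < ε) :
    ∃ v : E → V, MemLp v p ∧
      Tendsto (fun k => eLpNorm (fun x => F k x - v x) p volume) atTop (𝓝 0) := by
  have : Fact (1 ≤ p) := ⟨hp⟩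
  have hcauchy : CauchySeq fun k => (hF k).toLp (F k) := by
    rw [EMetric.cauchySeq_iff]
    intro ε hε
    obtain ⟨N, hN⟩ := hc ε hε
    refine ⟨N, fun j hj k hk => ?_⟩
    rw [Lp.edist_toLp_toLp]
    exact hN j k hj hk
  obtain ⟨v, hv⟩ := cauchySeq_tendsto_of_complete hcauchy
  refine ⟨v, Lp.memLp v, ?_⟩
  rw [tendsto_iff_edist_tendsto_0] at hv
  refine hv.congr fun k => ?_
  rw [Lp.edist_def]
  refine eLpNorm_congr_ae ?_
  filter_upwards [(hF k).coeFn_toLp] with x hx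
  simp [hx]

end Duality

/-! ### The comparison of fractional gradients -/

section Comparison

variable {n : ℕ} {Ω : TopologicalSpace.Opens (EuclideanSpace ℝ (Fin n))}

theorem TestFunction.isCompactLipschitz (φ : 𝓓(Ω, ℝ)) : IsCompactLipschitz φ :=
  ⟨φ.hasCompactSupport, φ.contDiff.lipschitzWith_of_hasCompactSupport φ.hasCompactSupport (by simp)⟩

theorem testFracGrad_eq_rieszGrad [NeZero n] {f : EuclideanSpace ℝ (Fin n) → ℝ}
    (hf : IsCompactLipschitz f) {s : ℝ} (hs : s ∈ Set.Ioo (0 : ℝ) 1) :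
    testFracGrad s f = rieszGrad ((1 - s) / 2) f :=
  funext fun x => testFracGrad_eq_integral_heatGrad hf hs.1 hs.2 x

theorem IsFracGrad.ae_eq [NeZero n] {s : ℝ} (hs : s ∈ Set.Ioo (0 : ℝ) 1) {p : ℝ≥0∞} (hp : 1 ≤ p)
    {u : EuclideanSpace ℝ (Fin n) → ℝ}
    {v w : EuclideanSpace ℝ (Fin n) → EuclideanSpace ℝ (Fin n)}
    (hv : IsFracGrad s p u v) (hw : IsFracGrad s p u w) : v =ᵐ[volume] w := by
  obtain ⟨hu, hvp, φ, hφu, hφv⟩ := hv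
  obtain ⟨-, hwp, ψ, hψu, hψw⟩ := hw
  have hα : 0 < (1 - s) / 2 := by linarith [hs.2]
  have hα' : (1 - s) / 2 < 1 / 2 := by linarith [hs.1]
  simp_rw [fun k => testFracGrad_eq_rieszGrad (φ k).isCompactLipschitz hs] at hφv
  simp_rw [fun k => testFracGrad_eq_rieszGrad (ψ k).isCompactLipschitz hs] at hψw
  have hφm := fun k => memLp_rieszGrad (φ k).isCompactLipschitz hα hα' hp
  have hψm := fun k => memLp_rieszGrad (ψ k).isCompactLipschitz hα hα' hp
  have h := ae_eq_zero_of_tendsto_rieszGrad hα hα' hp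
    (fun k => (φ k).isCompactLipschitz.sub (ψ k).isCompactLipschitz) (hvp.sub hwp) ?_ ?_
  · filter_upwards [h] with x hx using sub_eq_zero.1 hx
  · have h2 := hφu.add hψu
    rw [add_zero] at h2
    refine tendsto_of_tendsto_of_tendsto_of_le_of_le tendsto_const_nhds h2 (fun _ => zero_le)
      fun k => ?_
    have e : (fun x => φ k x - ψ k x) = (fun x => φ k x - u x) - fun x => ψ k x - u x := by
      ext x
      simp
    rw [e]
    exact eLpNorm_sub_le ((φ k).continuous.aestronglyMeasurable.sub hu.1)
      ((ψ k).continuous.aestronglyMeasurable.sub hu.1) hp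
  · have h2 := hφv.add hψw
    rw [add_zero] at h2
    refine tendsto_of_tendsto_of_tendsto_of_le_of_le tendsto_const_nhds h2 (fun _ => zero_le)
      fun k => ?_
    have e : (fun x => rieszGrad ((1 - s) / 2) (fun x => φ k x - ψ k x) x - (v - w) x) =
        (fun x => rieszGrad ((1 - s) / 2) (φ k) x - v x) -
          fun x => rieszGrad ((1 - s) / 2) (ψ k) x - w x := by
      ext1 x
      simp only [Pi.sub_apply]
      rw [rieszGrad_sub (φ k).isCompactLipschitz (ψ k).isCompactLipschitz hα hα']
      abel
    rw [e]
    exact eLpNorm_sub_le ((hφm k).1.sub hvp.1) ((hψm k).1.sub hwp.1) hp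

theorem IsFracGrad.fracGrad_ae_eq [NeZero n] {s : ℝ} (hs : s ∈ Set.Ioo (0 : ℝ) 1) {p : ℝ≥0∞}
    (hp : 1 ≤ p) {u : EuclideanSpace ℝ (Fin n) → ℝ}
    {v : EuclideanSpace ℝ (Fin n) → EuclideanSpace ℝ (Fin n)} (hv : IsFracGrad s p u v) :
    fracGrad s p u =ᵐ[volume] v := by
  have h : ∃ g, IsFracGrad s p u g := ⟨v, hv⟩
  rw [fracGrad, dif_pos h]
  exact IsFracGrad.ae_eq hs hp h.choose_spec hv

/-- The estimate for test functions, uniform in the order and in the exponent. -/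
theorem exists_eLpNorm_testFracGrad_le [NeZero n] {sbar : ℝ} (hsbar : sbar ∈ Set.Ioo (0 : ℝ) 1)
    (R : ℝ) : ∃ C : ℝ, 0 < C ∧ ∀ s ∈ Set.Ico sbar 1, ∀ p : ℝ≥0∞, 1 ≤ p → p ≠ ∞ →
      ∀ f : EuclideanSpace ℝ (Fin n) → ℝ, IsCompactLipschitz f → (∀ x, R < ‖x‖ → f x = 0) →
        eLpNorm (testFracGrad sbar f) p volume ≤
          ENNReal.ofReal C * eLpNorm (testFracGrad s f) p volume := by
  obtain ⟨C, hC0, hC⟩ := exists_eLpNorm_rieszGrad_add_le (E := EuclideanSpace ℝ (Fin n))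
    (show 0 < (1 - sbar) / 2 by linarith [hsbar.2])
    (show (1 - sbar) / 2 < 1 / 2 by linarith [hsbar.1]) R
  refine ⟨C + 1, by linarith, fun s hs p hp hp' f hf hfR => ?_⟩
  rcases eq_or_lt_of_le hs.1 with rfl | hlt
  · refine le_mul_of_one_le_left zero_le ?_
    rw [← ENNReal.ofReal_one]
    exact ENNReal.ofReal_le_ofReal (by linarith)
  · rw [testFracGrad_eq_rieszGrad hf hsbar,
      testFracGrad_eq_rieszGrad hf ⟨hsbar.1.trans hlt, hs.2⟩]
    refine (hC ((s - sbar) / 2) ((1 - s) / 2) (by linarith) (by linarith [hs.2]) (by ring) f hf hfR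
      p hp hp').trans (mul_le_mul_left (ENNReal.ofReal_le_ofReal (by linarith)) _)

/-- A sequence of test functions that converges in `L^p` and whose fractional gradients form a
Cauchy sequence defines a fractional gradient of its limit. -/
theorem exists_isFracGrad_of_cauchy [NeZero n] {s : ℝ} (hs : s ∈ Set.Ioo (0 : ℝ) 1) {p : ℝ≥0∞}
    (hp : 1 ≤ p) {u : EuclideanSpace ℝ (Fin n) → ℝ} (hu : MemLp u p) {φ : ℕ → 𝓓(Ω, ℝ)}
    (hφu : Tendsto (fun k => eLpNorm (fun x => φ k x - u x) p volume) atTop (𝓝 0))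
    (hc : ∀ ε : ℝ≥0∞, 0 < ε → ∃ N, ∀ j k, N ≤ j → N ≤ k →
      eLpNorm (testFracGrad s fun x => φ j x - φ k x) p volume < ε) :
    ∃ v, IsFracGrad s p u v ∧
      Tendsto (fun k => eLpNorm (fun x => testFracGrad s (φ k) x - v x) p volume) atTop (𝓝 0) := by
  have hα : 0 < (1 - s) / 2 := by linarith [hs.2]
  have hα' : (1 - s) / 2 < 1 / 2 := by linarith [hs.1]
  have hφ := fun k => (φ k).isCompactLipschitz
  have hm : ∀ k, MemLp (testFracGrad s (φ k)) p := fun k => by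
    rw [testFracGrad_eq_rieszGrad (hφ k) hs]
    exact memLp_rieszGrad (hφ k) hα hα' hp
  obtain ⟨v, hv, hlim⟩ := exists_memLp_tendsto_of_cauchy hp hm fun ε hε => by
    obtain ⟨N, hN⟩ := hc ε hε
    refine ⟨N, fun j k hj hk => ?_⟩
    have h := hN j k hj hk
    rw [testFracGrad_eq_rieszGrad ((hφ j).sub (hφ k)) hs] at h
    simp_rw [testFracGrad_eq_rieszGrad (hφ j) hs, testFracGrad_eq_rieszGrad (hφ k) hs,
      ← rieszGrad_sub (hφ j) (hφ k) hα hα']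
    exact h
  exact ⟨v, ⟨hu, hv, fun k => ⟨φ k, (φ k).contDiff, (φ k).hasCompactSupport, Set.subset_univ _⟩,
    hφu, hlim⟩, hlim⟩

theorem eLpNorm_testFracGrad_le_fracSobolevNorm (s : ℝ) {p : ℝ≥0∞} (hp : 1 ≤ p) (hp' : p ≠ ∞)
    (f : EuclideanSpace ℝ (Fin n) → ℝ) :
    eLpNorm (testFracGrad s f) p volume ≤ fracSobolevNorm s p f := by
  have hp0 : 0 < p.toReal := ENNReal.toReal_pos (zero_lt_one.trans_le hp).ne' hp'
  calc eLpNorm (testFracGrad s f) p volume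
      = (eLpNorm (testFracGrad s f) p volume ^ p.toReal) ^ p.toReal⁻¹ :=
        (ENNReal.rpow_rpow_inv hp0.ne' _).symm
    _ ≤ fracSobolevNorm s p f :=
        ENNReal.rpow_le_rpow le_add_self (by positivity)

end Comparison

theorem proposition3p9 (n : ℕ) (hn : 1 ≤ n) (sbar : ℝ) (hsbar : sbar ∈ Set.Ioo (0 : ℝ) 1)
    (Ω : TopologicalSpace.Opens (EuclideanSpace ℝ (Fin n)))
    (hΩ : Bornology.IsBounded (Ω : Set (EuclideanSpace ℝ (Fin n)))) :
    ∃ C : ℝ, 0 < C ∧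
      ∀ s : ℝ, s ∈ Set.Ico sbar 1 → ∀ p : ℝ≥0∞, 1 ≤ p → p ≠ ∞ →
        ∀ u : EuclideanSpace ℝ (Fin n) → ℝ, MemFracSobolevZero Ω s p u →
          (∃ g, IsFracGrad sbar p u g) ∧
            eLpNorm (fracGrad sbar p u) p volume ≤
              ENNReal.ofReal C * eLpNorm (fracGrad s p u) p volume := by
  have : NeZero n := ⟨by omega⟩
  obtain ⟨R, hR⟩ := hΩ.subset_closedBall 0
  obtain ⟨C, hC0, hC⟩ := exists_eLpNorm_testFracGrad_le (n := n) hsbar R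
  refine ⟨C, hC0, fun s hs p hp hp' u ⟨hu, φ, hφu, hcauchy⟩ => ?_⟩
  have hs' : s ∈ Set.Ioo (0 : ℝ) 1 := ⟨hsbar.1.trans_le hs.1, hs.2⟩
  have hφ := fun k => (φ k).isCompactLipschitz
  have hφR : ∀ k x, R < ‖x‖ → φ k x = 0 := by
    intro k x hx
    refine image_eq_zero_of_notMem_tsupport fun hmem => ?_
    have := hR ((φ k).tsupport_subset hmem)
    rw [mem_closedBall_zero_iff] at this
    linarith
  have hest : ∀ k, eLpNorm (testFracGrad sbar (φ k)) p volume ≤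
      ENNReal.ofReal C * eLpNorm (testFracGrad s (φ k)) p volume := fun k =>
    hC s hs p hp hp' _ (hφ k) (hφR k)
  have hcs : ∀ ε : ℝ≥0∞, 0 < ε → ∃ N, ∀ j k, N ≤ j → N ≤ k →
      eLpNorm (testFracGrad s fun x => φ j x - φ k x) p volume < ε := fun ε hε => by
    obtain ⟨N, hN⟩ := hcauchy ε hε
    exact ⟨N, fun j k hj hk =>
      (eLpNorm_testFracGrad_le_fracSobolevNorm s hp hp' _).trans_lt (hN j k hj hk)⟩
  have hcsbar : ∀ ε : ℝ≥0∞, 0 < ε → ∃ N, ∀ j k, N ≤ j → N ≤ k →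
      eLpNorm (testFracGrad sbar fun x => φ j x - φ k x) p volume < ε := fun ε hε => by
    have hC' : ENNReal.ofReal C ≠ 0 := (ENNReal.ofReal_pos.2 hC0).ne'
    obtain ⟨N, hN⟩ := hcs (ε / ENNReal.ofReal C) (ENNReal.div_pos hε.ne' ENNReal.ofReal_ne_top)
    refine ⟨N, fun j k hj hk => (hC s hs p hp hp' _ ((hφ j).sub (hφ k)) fun x hx => ?_).trans_lt ?_⟩
    · rw [hφR j x hx, hφR k x hx, sub_zero]
    · rw [mul_comm]
      exact (ENNReal.lt_div_iff_mul_lt (Or.inl hC') (Or.inl ENNReal.ofReal_ne_top)).1 (hN j k hj hk)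
  obtain ⟨v, hv, hvlim⟩ := exists_isFracGrad_of_cauchy hs' hp hu hφu hcs
  obtain ⟨w, hw, hwlim⟩ := exists_isFracGrad_of_cauchy hsbar hp hu hφu hcsbar
  refine ⟨⟨w, hw⟩, ?_⟩
  rw [eLpNorm_congr_ae (hv.fracGrad_ae_eq hs' hp), eLpNorm_congr_ae (hw.fracGrad_ae_eq hsbar hp)]
  have hm : ∀ {σ : ℝ}, σ ∈ Set.Ioo (0 : ℝ) 1 → ∀ k,
      AEStronglyMeasurable (testFracGrad σ (φ k)) := fun {σ} hσ k => by
    rw [testFracGrad_eq_rieszGrad (hφ k) hσ]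
    exact (stronglyMeasurable_rieszGrad (hφ k).continuous _).aestronglyMeasurable
  have hbound : ∀ k, eLpNorm w p volume ≤
      eLpNorm (fun x => testFracGrad sbar (φ k) x - w x) p volume + ENNReal.ofReal C *
        (eLpNorm (fun x => testFracGrad s (φ k) x - v x) p volume + eLpNorm v p volume) := by
    intro k
    have e1 : w = testFracGrad sbar (φ k) - fun x => testFracGrad sbar (φ k) x - w x := by
      ext1 x
      simp
    have e2 : testFracGrad s (φ k) = (fun x => testFracGrad s (φ k) x - v x) + v := by
      ext1 x
      simp
    calc eLpNorm w p volume
        = eLpNorm (testFracGrad sbar (φ k) - fun x => testFracGrad sbar (φ k) x - w x) p volume := by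
          rw [← e1]
      _ ≤ eLpNorm (testFracGrad sbar (φ k)) p volume +
            eLpNorm (fun x => testFracGrad sbar (φ k) x - w x) p volume :=
          eLpNorm_sub_le (hm hsbar k) ((hm hsbar k).sub hw.2.1.1) hp
      _ ≤ ENNReal.ofReal C * eLpNorm (testFracGrad s (φ k)) p volume +
            eLpNorm (fun x => testFracGrad sbar (φ k) x - w x) p volume :=
          add_le_add_left (hest k) _
      _ ≤ ENNReal.ofReal C *
            (eLpNorm (fun x => testFracGrad s (φ k) x - v x) p volume + eLpNorm v p volume) +
            eLpNorm (fun x => testFracGrad sbar (φ k) x - w x) p volume := by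
          refine add_le_add_left (mul_le_mul_right ?_ _) _
          nth_rewrite 1 [e2]
          exact eLpNorm_add_le ((hm hs' k).sub hv.2.1.1) hv.2.1.1 hp
      _ = _ := add_comm _ _
  have hlim := hwlim.add (ENNReal.Tendsto.const_mul (hvlim.add_const (eLpNorm v p volume))
    (Or.inr (ENNReal.ofReal_ne_top (r := C))))
  rw [zero_add, zero_add] at hlim
  exact ge_of_tendsto' hlim hbound
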